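/- Let $m\ge 0$, $a\in\mathbb R$, and let ${\bf g}_{m,a}=\boldsymbol\eta+2H\,\boldsymbol\ell\otimes\boldsymbol\ell$ be the Kerr metric in Kerr–Schild coordinates $(t,x,y,z)$, where $\boldsymbol\eta=\mathrm{diag}(-1,1,1,1)$, $$H=\frac{m\tilde r^3}{\tilde r^4+a^2z^2},\qquad \boldsymbol\ell=\Big(1,\frac{\tilde r x+ay}{\tilde r^2+a^2},\frac{\tilde r y-ax}{\tilde r^2+a^2},\frac{z}{\tilde r}\Big),$$ and $\tilde r>0$ is defined by $\frac{x^2+y^2}{\tilde r^2+a^2}+\frac{z^2}{\tilde r^2}=1$. Let $g=g_{m,a}$ and $k=k_{m,a}$ be the metric and the second fundamental form $k_{ij}=-\frac12(\mathcal L_{\bf n}{\bf g}_{m,a})_{ij}$ induced on $\{t=0\}$, with ${\bf n}$ the future unit normal of the slices of constant $t$. On the coordinate sphere $\partial B_r=\{x^2+y^2+z^2=r^2\}$, with Euclidean outward unit normal $\nu$ and area element $dS$, Euclidean metric $e$ and Cartesian coordinates $(x_1,x_2,x_3)=(x,y,z)$, put (repeated indices summed) $$\mathbf E=\tfrac12\int_{\partial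 B_r}(\partial_ig_{ij}-\partial_jg_{ii})\nu^j\,dS,\qquad \mathbf P_i=\int_{\partial B_r}(k_{ij}-\delta_{ij}\,\mathrm{tr}_e k)\nu^j\,dS,$$ $$\mathbf C_l=\tfrac12\int_{\partial B_r}\big(x_l(\partial_ig_{ij}-\partial_jg_{ii})-\delta_{il}(g-e)_{ij}+\delta_{jl}(g-e)_{ii}\big)\nu^j\,dS,\qquad \mathbf J_l=\int_{\partial B_r}(k_{ij}-\delta_{ij}\,\mathrm{tr}_e k)Y_l^i\nu^j\,dS,$$ where $Y_l=\mathbf e_l\times x$. Then $g$ and $k$ are smooth on $\{|x|>|a|\}$, and there is a universal constant $R_0\ge1$ such that, on the region $r>R_0(m+|a|)$, $$\mathbf E=8\pi m+\mathcal O^3_2,\qquad \mathbf P=\mathcal O^3_2,\qquad \mathbf C=\mathcal O^3_1,\qquad \mathbf J=8\pi am\,\mathbf e_z+\mathcal O^3_1 .$$ Here, for a function $X$ of $r$ depending on the parameters $m,a$ (componentwise for vectors), $X=\mathcal O^p_q$ means that $X$ is smooth in $r>R_0(m+|a|)$ and that for every $l\in\mathbb N$ there is a constant $C_l$, independent of $m$,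 $a$ and $r$, with $$\Big|\frac{d^l X}{dr^l}\Big|\le C_l\,\frac{(m+|a|)^p}{r^{q+l}}\qquad\text{for all } r>R_0(m+|a|).$$ -/

import Mathlib

open scoped ContDiff Matrix

noncomputable section

namespace KerrADM

/-- Euclidean three-space with its Cartesian coordinates `x 0, x 1, x 2` (that is, `x, y, z`). -/
abbrev Space := EuclideanSpace ℝ (Fin 3)

/-- The coordinate spacetime `ℝ^{1+3}`, with coordinates `(t, x, y, z) = (p 0, p 1, p 2, p 3)`. -/
abbrev Spacetime := Fin 4 → ℝ

/-- The coordinate derivative `∂_i f` of a function on three-space. -/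
def pd (i : Fin 3) (f : Space → ℝ) (x : Space) : ℝ :=
  fderiv ℝ f x (EuclideanSpace.single i 1)

/-- The coordinate derivative `∂_μ f` of a function on spacetime. -/
def spacetimePd (μ : Fin 4) (f : Spacetime → ℝ) (p : Spacetime) : ℝ :=
  fderiv ℝ f p (Pi.single μ 1)

/-! ## Initial data induced on the slice `t = 0` by a spacetime metric -/

/-- A symmetric two-tensor `g` and a symmetric two-tensor `k` on three-space, in components. -/
structure InitialData where
  g : Space → Matrix (Fin 3) (Fin 3) ℝ
  k : Space → Matrix (Fin 3) (Fin 3) ℝ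

/-- The inclusion of the slice `Σ₀ = {t = 0}`. -/
def slice (x : Space) : Spacetime := ![0, x 0, x 1, x 2]

/-- The lapse `α = (-G^{00})^{-1/2}` of the foliation by the level sets of `t`. -/
def lapse (G : Spacetime → Matrix (Fin 4) (Fin 4) ℝ) (p : Spacetime) : ℝ :=
  1 / √(-((G p)⁻¹ 0 0))

/-- The future unit normal `n^μ = G^{μν} n_ν`, `n_ν = (-α, 0, 0, 0)`, of the level sets of `t`. -/
def unitNormal (G : Spacetime → Matrix (Fin 4) (Fin 4) ℝ) (p : Spacetime) : Fin 4 → ℝ :=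
  (G p)⁻¹ *ᵥ ![-lapse G p, 0, 0, 0]

/-- The Lie derivative
`(L_V G)_{μν} = V^λ ∂_λ G_{μν} + G_{λν} ∂_μ V^λ + G_{μλ} ∂_ν V^λ`. -/
def lieDeriv (V : Spacetime → Fin 4 → ℝ) (G : Spacetime → Matrix (Fin 4) (Fin 4) ℝ)
    (p : Spacetime) : Matrix (Fin 4) (Fin 4) ℝ :=
  Matrix.of fun μ ν => ∑ l : Fin 4,
    (V p l * spacetimePd l (fun q => G q μ ν) p
      + G p l ν * spacetimePd μ (fun q => V q l) p
      + G p μ l * spacetimePd ν (fun q => V q l) p)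

/-- The initial data induced on `{t = 0}`: the restriction `g_{ij} = G_{ij}` and the second
fundamental form `k_{ij} = -½ (L_n G)_{ij}`, with `n` the future unit normal. -/
def inducedData (G : Spacetime → Matrix (Fin 4) (Fin 4) ℝ) : InitialData where
  g x := Matrix.of fun i j => G (slice x) i.succ j.succ
  k x := Matrix.of fun i j => -(1 / 2) * lieDeriv (unitNormal G) G (slice x) i.succ j.succ

/-! ## The Kerr metric in Kerr-Schild coordinates -/

/-- The Kerr-Schild radius. By `kerrRadius_pos` and `eq_kerrRadius_iff` below it is, for
`x² + y² + z² > a²`, the unique positive solution `ρ` of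
`(x² + y²) / (ρ² + a²) + z² / ρ² = 1`. -/
def kerrRadius (a x y z : ℝ) : ℝ :=
  √((x ^ 2 + y ^ 2 + z ^ 2 - a ^ 2
    + √((x ^ 2 + y ^ 2 + z ^ 2 - a ^ 2) ^ 2 + 4 * a ^ 2 * z ^ 2)) / 2)

theorem kerrRadius_pos {a x y z : ℝ} (h : a ^ 2 < x ^ 2 + y ^ 2 + z ^ 2) :
    0 < kerrRadius a x y z := by
  unfold kerrRadius
  apply Real.sqrt_pos.2
  have := Real.sqrt_nonneg
    ((x ^ 2 + y ^ 2 + z ^ 2 - a ^ 2) ^ 2 + 4 * a ^ 2 * z ^ 2)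
  linarith

theorem eq_kerrRadius_iff {a x y z ρ : ℝ} (h : a ^ 2 < x ^ 2 + y ^ 2 + z ^ 2) (hρ : 0 < ρ) :
    (x ^ 2 + y ^ 2) / (ρ ^ 2 + a ^ 2) + z ^ 2 / ρ ^ 2 = 1 ↔ ρ = kerrRadius a x y z := by
  set b := x ^ 2 + y ^ 2 + z ^ 2 - a ^ 2 with hb
  have hb0 : 0 < b := by linarith
  set s := √(b ^ 2 + 4 * a ^ 2 * z ^ 2) with hs
  have hs0 : 0 ≤ s := Real.sqrt_nonneg _
  have hs2 : s ^ 2 = b ^ 2 + 4 * a ^ 2 * z ^ 2 := Real.sq_sqrt (by positivity)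
  have hρ2 : 0 < ρ ^ 2 := by positivity
  have key : (x ^ 2 + y ^ 2) / (ρ ^ 2 + a ^ 2) + z ^ 2 / ρ ^ 2 = 1 ↔
      ρ ^ 2 * ρ ^ 2 - b * ρ ^ 2 - a ^ 2 * z ^ 2 = 0 := by
    rw [div_add_div _ _ (by positivity) (by positivity), div_eq_one_iff_eq (by positivity)]
    constructor <;> intro h1 <;> rw [hb] at * <;> linarith
  have hdef : kerrRadius a x y z = √((b + s) / 2) := rfl
  rw [key, hdef, eq_comm (a := ρ), Real.sqrt_eq_iff_eq_sq (by linarith) hρ.le]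
  constructor
  · intro h1
    have h2 : (2 * ρ ^ 2 - b) ^ 2 = s ^ 2 := by rw [hs2]; nlinarith
    have h3 : 0 ≤ 2 * ρ ^ 2 - b := by
      have : 0 ≤ ρ ^ 2 * (ρ ^ 2 - b) := by nlinarith [mul_nonneg (sq_nonneg a) (sq_nonneg z)]
      have := nonneg_of_mul_nonneg_right this hρ2
      linarith
    have h4 : 2 * ρ ^ 2 - b = s := (sq_eq_sq₀ h3 hs0).1 h2
    linarith
  · intro h1
    rw [← h1]
    nlinarith

/-- The function `H = m ρ³ / (ρ⁴ + a² z²)`, with `ρ` the Kerr-Schild radius. -/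
def kerrH (m a : ℝ) (p : Spacetime) : ℝ :=
  let ρ := kerrRadius a (p 1) (p 2) (p 3)
  m * ρ ^ 3 / (ρ ^ 4 + a ^ 2 * (p 3) ^ 2)

/-- The null covector `ℓ = (1, (ρ x + a y)/(ρ² + a²), (ρ y - a x)/(ρ² + a²), z/ρ)`. -/
def kerrEll (a : ℝ) (p : Spacetime) : Fin 4 → ℝ :=
  let ρ := kerrRadius a (p 1) (p 2) (p 3)
  ![1, (ρ * p 1 + a * p 2) / (ρ ^ 2 + a ^ 2), (ρ * p 2 - a * p 1) / (ρ ^ 2 + a ^ 2), p 3 / ρ]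

/-- The Minkowski metric `diag(-1, 1, 1, 1)`. -/
def minkowski : Matrix (Fin 4) (Fin 4) ℝ := Matrix.diagonal ![-1, 1, 1, 1]

/-- The Kerr metric `η_{μν} + 2 H ℓ_μ ℓ_ν`. -/
def kerrMetric (m a : ℝ) (p : Spacetime) : Matrix (Fin 4) (Fin 4) ℝ :=
  minkowski + (2 * kerrH m a p) • Matrix.vecMulVec (kerrEll a p) (kerrEll a p)

/-- The Kerr initial data on `{t = 0}`. -/
def kerrData (m a : ℝ) : InitialData := inducedData (kerrMetric m a)

/-! ## Localized ADM charges on coordinate spheres -/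

/-- The surface integral `∫_{∂B_r} f(x, ν) dS` over the sphere of radius `r > 0` about the origin,
with `ν = x / r` the outward unit normal: the points are `x = r w` with `w` in the unit sphere,
`ν = w`, and `dS = r² dσ(w)` with `σ` the surface measure of the unit sphere. -/
def sphereIntegral (r : ℝ) (f : Space → Space → ℝ) : ℝ :=
  r ^ 2 * ∫ w : Metric.sphere (0 : Space) 1, f (r • (w : Space)) w
    ∂(MeasureTheory.volume : MeasureTheory.Measure Space).toSphere

/-- The Kronecker delta, i.e. the components of the Euclidean metric `e`. -/
def δ (i j : Fin 3) : ℝ := if i = j then 1 else 0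

/-- The covector `∂_i g_{ij} - ∂_j g_{ii}` (summed over `i`). -/
def massCovector (D : InitialData) (x : Space) (j : Fin 3) : ℝ :=
  ∑ i : Fin 3, (pd i (fun y => D.g y i j) x - pd j (fun y => D.g y i i) x)

/-- The tensor `k_{ij} - δ_{ij} tr_e k`. -/
def momentumTensor (D : InitialData) (x : Space) (i j : Fin 3) : ℝ :=
  D.k x i j - δ i j * (D.k x).trace

/-- The rotation field `Y_l^i = ε_{lji} x^j`, that is `Y_l = e_l × x`. -/
def rotationField (l : Fin 3) (x : Space) : Fin 3 → ℝ :=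
  crossProduct (Pi.single l (1 : ℝ)) (fun j => x j)

/-- `E[(g,k); ∂B_r] = ½ ∫ (∂_i g_{ij} - ∂_j g_{ii}) ν^j dS`. -/
def energy (D : InitialData) (r : ℝ) : ℝ :=
  1 / 2 * sphereIntegral r fun x ν => ∑ j : Fin 3, massCovector D x j * ν j

/-- `P_i[(g,k); ∂B_r] = ∫ (k_{ij} - δ_{ij} tr_e k) ν^j dS`. -/
def momentum (D : InitialData) (i : Fin 3) (r : ℝ) : ℝ :=
  sphereIntegral r fun x ν => ∑ j : Fin 3, momentumTensor D x i j * ν j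

/-- `C_l[(g,k); ∂B_r]
  = ½ ∫ (x_l (∂_i g_{ij} - ∂_j g_{ii}) - δ_{il} (g-e)_{ij} + δ_{jl} (g-e)_{ii}) ν^j dS`. -/
def center (D : InitialData) (l : Fin 3) (r : ℝ) : ℝ :=
  1 / 2 * sphereIntegral r fun x ν => ∑ j : Fin 3,
    (x l * massCovector D x j
      - ∑ i : Fin 3, δ i l * (D.g x i j - δ i j)
      + δ j l * ∑ i : Fin 3, (D.g x i i - δ i i)) * ν j

/-- `J_l[(g,k); ∂B_r] = ∫ (k_{ij} - δ_{ij} tr_e k) Y_l^i ν^j dS`. -/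
def angularMomentum (D : InitialData) (l : Fin 3) (r : ℝ) : ℝ :=
  sphereIntegral r fun x ν => ∑ i : Fin 3, ∑ j : Fin 3,
    momentumTensor D x i j * rotationField l x i * ν j

/-! ## Weighted error terms -/

/-- For a family `X m a r` of functions of the radius, `X = O^p_q` in the far region
`r > R₀ (m + |a|)`: there `X m a` is smooth and, for every `l`,
`|∂_r^l X| ≤ C_l (m + |a|)^p / r^(q + l)`, with `C_l` independent of `m ≥ 0`, `a` and `r`. -/
def IsKerrO (R₀ : ℝ) (p q : ℕ) (X : ℝ → ℝ → ℝ → ℝ) : Prop :=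
  (∀ m a : ℝ, 0 ≤ m → ContDiffOn ℝ ∞ (X m a) (Set.Ioi (R₀ * (m + |a|)))) ∧
  ∀ l : ℕ, ∃ C : ℝ, ∀ m a r : ℝ, 0 ≤ m → R₀ * (m + |a|) < r →
    |iteratedDeriv l (X m a) r| ≤ C * (m + |a|) ^ p / r ^ (q + l)

end KerrADM

end

/-! The proof rests on scaling and discrete symmetry. The Kerr–Schild functions are homogeneous when
a is scaled together with x, so pulling a flux integral back to the unit sphere leaves a function of
m/r and a/r alone.

Energy: g - e is exactly linear in m, hence E = m Φ(a/r) with Φ smooth near 0. Reflecting y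
exchanges a and -a, so Φ is even; Φ(0) = 8π is the Schwarzschild value. The error is m times a
function vanishing to second order, which gives O^3_2 (`energy_kerrData`, `massFlux_zero`,
`isKerrO_energy`).

Angular momentum about z: contracting k with the rotation field and the position extracts a factor m
a, so J_z = m a Ψ(m/r, a/r) with Ψ(0) = 8π. First-order vanishing of Ψ - 8π gives O^3_1
(`sum_ksSecondForm_rotation`, `sum_kerrData_k_rotation`, `isKerrO_angularMomentum`).

The remaining charges vanish identically. The tensors g and k are even under x ↦ -x, which makes the
integrands of P and C odd; the half turn about the z-axis makes those of J_x and J_y odd.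

Radial derivatives cost nothing extra: the l-th r-derivative of F(q/r) is r^{-l} times another
smooth profile at q/r that vanishes at 0 to the same order (`iteratedDeriv_comp_inv_smul`,
`isKerrO_of_scaling`). -/

noncomputable section

namespace KerrADM

open MeasureTheory Metric Set Filter Topology
open scoped Pointwise

/-! ### Smooth dependence on parameters of integrals over a compact space. -/

section ParametricIntegral

variable {E V T : Type} [NormedAddCommGroup E] [NormedSpace ℝ E] [ProperSpace E]
  [NormedAddCommGroup V] [NormedSpace ℝ V]
  [TopologicalSpace T] [CompactSpace T] [SecondCountableTopology T] [MeasurableSpace T]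
  [BorelSpace T] {μ : Measure T} [IsFiniteMeasure μ]

/-- Differentiation under an integral over a compact space of a jointly smooth integrand. -/
theorem hasFDerivAt_integral_of_contDiffAt {G : Type} [NormedAddCommGroup G] [NormedSpace ℝ G]
    {e : T → V} (he : Continuous e) {U : Set E} (hU : IsOpen U) {h : E × V → G}
    (hh : ∀ x ∈ U, ∀ t, ContDiffAt ℝ ∞ h (x, e t)) {x : E} (hx : x ∈ U) :
    HasFDerivAt (fun x => ∫ t, h (x, e t) ∂μ)
      (∫ t, (fderiv ℝ h (x, e t)).comp (ContinuousLinearMap.inl ℝ E V) ∂μ) x := by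
  have hcont : ∀ y ∈ U, Continuous fun t => h (y, e t) := fun y hy =>
    continuous_iff_continuousAt.2 fun t =>
      ContinuousAt.comp (f := fun t => (y, e t)) (hh y hy t).continuousAt (by fun_prop)
  have hcont' : ∀ y ∈ U, ∀ t, ContinuousAt (fun p : E × T =>
      (fderiv ℝ h (p.1, e p.2)).comp (ContinuousLinearMap.inl ℝ E V)) (y, t) := by
    intro y hy t
    have h1 : ContinuousAt (fderiv ℝ h) (y, e t) :=
      ((hh y hy t).fderiv_right (m := ∞) (by simp)).continuousAt
    have h2 : ContinuousAt (fun p : E × T => fderiv ℝ h (p.1, e p.2)) (y, t) :=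
      ContinuousAt.comp (f := fun p : E × T => (p.1, e p.2)) (x := (y, t)) h1 (by fun_prop)
    exact h2.clm_comp continuousAt_const
  -- A closed ball times the compact space `T` is compact, so one constant dominates the derivative
  -- near `x`.
  obtain ⟨ε, hε, hεU⟩ := Metric.nhds_basis_closedBall.mem_iff.1 (hU.mem_nhds hx)
  obtain ⟨C, hC⟩ := ((isCompact_closedBall x ε).prod
    (isCompact_univ (X := T))).exists_bound_of_continuousOn
    (f := fun p : E × T => (fderiv ℝ h (p.1, e p.2)).comp (ContinuousLinearMap.inl ℝ E V))
    (fun p hp => (hcont' p.1 (hεU hp.1) p.2).continuousWithinAt)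
  refine hasFDerivAt_integral_of_dominated_of_fderiv_le (closedBall_mem_nhds x hε)
    (F := fun x t => h (x, e t))
    (F' := fun x t => (fderiv ℝ h (x, e t)).comp (ContinuousLinearMap.inl ℝ E V))
    (bound := fun _ => C) ?_ ?_ ?_ ?_ (integrable_const _) ?_
  · filter_upwards [hU.mem_nhds hx] with y hy using (hcont y hy).aestronglyMeasurable
  · exact (hcont x hx).integrable_of_hasCompactSupport (HasCompactSupport.of_compactSpace _)
  · refine Continuous.aestronglyMeasurable (continuous_iff_continuousAt.2 fun t => ?_)
    exact ContinuousAt.comp (f := fun t => (x, t)) (hcont' x hx t) (by fun_prop)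
  · exact Eventually.of_forall fun t y hy => hC (y, t) ⟨hy, mem_univ _⟩
  · refine Eventually.of_forall fun t y hy => ?_
    have h1 : HasFDerivAt h (fderiv ℝ h (y, e t)) (y, e t) :=
      ((hh y (hεU hy) t).differentiableAt (by simp)).hasFDerivAt
    exact h1.comp y (hasFDerivAt_prodMk_left y (e t))

/-- The derivative of the integral is an integral of the same kind with values in `E →L[ℝ] G`, so
induction on the order works once `G` is generalized. The integrand lives on `E × V`, with `T`
entering only through `e`, so that `T` needs no differentiable structure. -/
theorem contDiffOn_integral_of_contDiffAt {G : Type} [NormedAddCommGroup G] [NormedSpace ℝ G]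
    {e : T → V} (he : Continuous e) {U : Set E} (hU : IsOpen U) {h : E × V → G}
    (hh : ∀ x ∈ U, ∀ t, ContDiffAt ℝ ∞ h (x, e t)) :
    ContDiffOn ℝ ∞ (fun x => ∫ t, h (x, e t) ∂μ) U := by
  rw [contDiffOn_infty]
  intro n
  induction n generalizing G with
  | zero =>
    exact contDiffOn_zero.2 fun x hx =>
      (hasFDerivAt_integral_of_contDiffAt he hU hh hx).continuousAt.continuousWithinAt
  | succ n ih =>
    push_cast
    rw [contDiffOn_succ_iff_fderiv_of_isOpen hU]
    refine ⟨fun x hx => (hasFDerivAt_integral_of_contDiffAt he hU hh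
      hx).differentiableAt.differentiableWithinAt, by simp, ?_⟩
    refine (ih (h := fun p => (fderiv ℝ h p).comp (ContinuousLinearMap.inl ℝ E V)) ?_).congr
      fun x hx => (hasFDerivAt_integral_of_contDiffAt he hU hh hx).fderiv
    intro x hx t
    exact ((hh x hx t).fderiv_right (m := ∞) (by simp)).clm_comp contDiffAt_const

end ParametricIntegral

/-! ### Radial derivatives of rescaled profiles and their remainder bounds. -/

section Scaling

variable {E : Type} [NormedAddCommGroup E] [NormedSpace ℝ E]

/-- `scaledDeriv F l` is the profile of the `l`-th derivative of `r ↦ F (r⁻¹ • q)`. -/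
def scaledDeriv (F : E → ℝ) : ℕ → E → ℝ
  | 0 => F
  | l + 1 => fun x => -(l : ℝ) * scaledDeriv F l x - fderiv ℝ (scaledDeriv F l) x x

theorem contDiffOn_fderiv_infty {G : Type} [NormedAddCommGroup G] [NormedSpace ℝ G]
    {F : E → G} {U : Set E} (hU : IsOpen U)
    (hF : ContDiffOn ℝ ∞ F U) : ContDiffOn ℝ ∞ (fderiv ℝ F) U :=
  hF.fderiv_of_isOpen hU (by simp)

theorem contDiffOn_scaledDeriv {F : E → ℝ} {U : Set E} (hU : IsOpen U) (hF : ContDiffOn ℝ ∞ F U)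
    (l : ℕ) : ContDiffOn ℝ ∞ (scaledDeriv F l) U := by
  induction l with
  | zero => exact hF
  | succ l ih =>
    exact (contDiffOn_const.mul ih).sub ((contDiffOn_fderiv_infty hU ih).clm_apply contDiffOn_id)

theorem norm_inv_smul_lt {q : E} {c r : ℝ} (hr : 0 < r) (h : ‖q‖ < c * r) : ‖r⁻¹ • q‖ < c := by
  rw [norm_smul, norm_inv, Real.norm_of_nonneg hr.le, inv_mul_lt_iff₀ hr]
  linarith

/-- Differentiating r^{-l} G(q/r) gives r^{-l-1} (-l G - DG(x) x) at x = q/r, which is the recursion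
defining `scaledDeriv`. -/
theorem iteratedDeriv_comp_inv_smul {F : E → ℝ} {c : ℝ} (hF : ContDiffOn ℝ ∞ F (ball 0 c))
    (q : E) (l : ℕ) {r : ℝ} (hr : 0 < r) (hq : ‖q‖ < c * r) :
    iteratedDeriv l (fun r => F (r⁻¹ • q)) r = (r ^ l)⁻¹ * scaledDeriv F l (r⁻¹ • q) := by
  induction l generalizing r with
  | zero => simp [scaledDeriv]
  | succ l ih =>
    have hopen : IsOpen {r : ℝ | 0 < r ∧ ‖q‖ < c * r} :=
      (isOpen_lt continuous_const continuous_id).inter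
        (isOpen_lt continuous_const (continuous_const.mul continuous_id))
    have hev : iteratedDeriv l (fun r => F (r⁻¹ • q)) =ᶠ[𝓝 r]
        fun r => (r ^ l)⁻¹ * scaledDeriv F l (r⁻¹ • q) := by
      filter_upwards [hopen.mem_nhds (show r ∈ {r : ℝ | 0 < r ∧ ‖q‖ < c * r} from ⟨hr, hq⟩)]
        with s hs using ih hs.1 hs.2
    rw [iteratedDeriv_succ, hev.deriv_eq]
    have hmem : r⁻¹ • q ∈ ball (0 : E) c := by
      simpa using norm_inv_smul_lt hr hq
    have hd : HasFDerivAt (scaledDeriv F l) (fderiv ℝ (scaledDeriv F l) (r⁻¹ • q)) (r⁻¹ • q) :=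
      (((contDiffOn_scaledDeriv isOpen_ball hF l).contDiffAt
        (isOpen_ball.mem_nhds hmem)).differentiableAt (by simp)).hasFDerivAt
    have hi : HasDerivAt (fun r : ℝ => r⁻¹ • q) ((-(r ^ 2)⁻¹) • q) r :=
      (hasDerivAt_inv hr.ne').smul_const q
    have h1 := hd.comp_hasDerivAt r hi
    have h2 : HasDerivAt (fun r : ℝ => (r ^ l)⁻¹) (-(l * r ^ (l - 1)) / (r ^ l) ^ 2) r :=
      (hasDerivAt_pow l r).fun_inv (by positivity)
    refine (h2.mul h1).deriv.trans ?_
    have h3 : (-(r ^ 2)⁻¹) • q = (-r⁻¹) • (r⁻¹ • q) := by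
      rw [smul_smul]; congr 1; field_simp
    rw [h3, map_smul]
    simp only [scaledDeriv, smul_eq_mul, Function.comp]
    -- The exponent `l - 1` from the power rule is a truncated subtraction, so `l = 0` is treated
    -- apart.
    rcases l with _ | l
    · simp
    · simp only [Nat.add_sub_cancel]
      field_simp
      push_cast
      ring

theorem scaledDeriv_zero {F : E → ℝ} (h : F 0 = 0) (l : ℕ) : scaledDeriv F l 0 = 0 := by
  induction l with
  | zero => exact h
  | succ l ih => simp [scaledDeriv, ih]

/-- The operator G ↦ -l G - DG(x) x does not lower the order of vanishing at the origin: its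
derivative at 0 involves only DG(0) and D²G(0) applied to 0. -/
theorem fderiv_scaledDeriv_zero {F : E → ℝ} {U : Set E} (hU : IsOpen U) (h0 : (0 : E) ∈ U)
    (hF : ContDiffOn ℝ ∞ F U) (h : fderiv ℝ F 0 = 0) (l : ℕ) :
    fderiv ℝ (scaledDeriv F l) 0 = 0 := by
  induction l with
  | zero => exact h
  | succ l ih =>
    have hs := (contDiffOn_scaledDeriv hU hF l)
    have h1 : HasFDerivAt (scaledDeriv F l) (0 : E →L[ℝ] ℝ) 0 := by
      rw [← ih]
      exact ((hs.contDiffAt (hU.mem_nhds h0)).differentiableAt (by simp)).hasFDerivAt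
    have h2 : HasFDerivAt (fderiv ℝ (scaledDeriv F l)) (fderiv ℝ (fderiv ℝ (scaledDeriv F l)) 0) 0 :=
      (((contDiffOn_fderiv_infty hU hs).contDiffAt
        (hU.mem_nhds h0)).differentiableAt (by simp)).hasFDerivAt
    have h3 := (h1.const_mul (-(l : ℝ))).sub (h2.clm_apply (hasFDerivAt_id (0 : E)))
    refine h3.fderiv.trans ?_
    ext v
    simp [ih]

/-- Mean value inequality on the ball of radius ‖x‖, where the derivative is at most C‖x‖^k. Each
application gains one power, so two of them give the quadratic remainder. -/
theorem norm_sub_le_of_fderiv_le_pow {G : Type} [NormedAddCommGroup G] [NormedSpace ℝ G]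
    {F : E → G} {c C : ℝ} {k : ℕ} (hC : 0 ≤ C)
    (hd : ∀ x ∈ closedBall (0 : E) c, DifferentiableAt ℝ F x)
    (hb : ∀ x ∈ closedBall (0 : E) c, ‖fderiv ℝ F x‖ ≤ C * ‖x‖ ^ k) {x : E}
    (hx : x ∈ closedBall (0 : E) c) : ‖F x - F 0‖ ≤ C * ‖x‖ ^ (k + 1) := by
  have hxc : ‖x‖ ≤ c := by simpa using hx
  have hsub : closedBall (0 : E) ‖x‖ ⊆ closedBall 0 c := closedBall_subset_closedBall hxc
  have := (convex_closedBall (0 : E) ‖x‖).norm_image_sub_le_of_norm_fderiv_le (𝕜 := ℝ)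
    (C := C * ‖x‖ ^ k) (fun y hy => hd y (hsub hy))
    (fun y hy => (hb y (hsub hy)).trans (by
      have : ‖y‖ ≤ ‖x‖ := by simpa using hy
      gcongr)) (x := 0) (y := x) (by simp) (by simp)
  simpa [pow_succ, mul_assoc] using this

theorem exists_norm_sub_le {G : Type} [NormedAddCommGroup G] [NormedSpace ℝ G] [ProperSpace E]
    {F : E → G} {c c' : ℝ} (hc : c' < c) (hF : ContDiffOn ℝ ∞ F (ball 0 c)) :
    ∃ C, 0 ≤ C ∧ ∀ x ∈ closedBall (0 : E) c', ‖F x - F 0‖ ≤ C * ‖x‖ := by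
  have hsub : closedBall (0 : E) c' ⊆ ball 0 c := closedBall_subset_ball hc
  obtain ⟨C, hC⟩ := (isCompact_closedBall (0 : E) c').exists_bound_of_continuousOn
    ((contDiffOn_fderiv_infty isOpen_ball hF).continuousOn.mono hsub)
  refine ⟨max C 0, le_max_right _ _, fun x hx => ?_⟩
  simpa using norm_sub_le_of_fderiv_le_pow (k := 0) (le_max_right C 0)
    (fun y hy => (hF.contDiffAt (isOpen_ball.mem_nhds (hsub hy))).differentiableAt (by simp))
    (fun y hy => by simpa using Or.inl (hC y hy)) hx

theorem exists_norm_sub_le_sq {G : Type} [NormedAddCommGroup G] [NormedSpace ℝ G] [ProperSpace E]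
    {F : E → G} {c c' : ℝ} (hc : c' < c) (hF : ContDiffOn ℝ ∞ F (ball 0 c))
    (h0 : fderiv ℝ F 0 = 0) :
    ∃ C, 0 ≤ C ∧ ∀ x ∈ closedBall (0 : E) c', ‖F x - F 0‖ ≤ C * ‖x‖ ^ 2 := by
  have hsub : closedBall (0 : E) c' ⊆ ball 0 c := closedBall_subset_ball hc
  obtain ⟨C, hC0, hC⟩ := exists_norm_sub_le hc (contDiffOn_fderiv_infty isOpen_ball hF)
  refine ⟨C, hC0, fun x hx => ?_⟩
  exact norm_sub_le_of_fderiv_le_pow hC0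
    (fun y hy => (hF.contDiffAt (isOpen_ball.mem_nhds (hsub hy))).differentiableAt (by simp))
    (fun y hy => by simpa [h0] using hC y hy) hx

theorem fderiv_zero_of_even {F : E → ℝ} {c : ℝ} (hc : 0 < c) (hF : ContDiffOn ℝ ∞ F (ball 0 c))
    (he : ∀ x ∈ ball (0 : E) c, F (-x) = F x) : fderiv ℝ F 0 = 0 := by
  have h1 : HasFDerivAt F (fderiv ℝ F 0) 0 :=
    ((hF.contDiffAt (ball_mem_nhds 0 hc)).differentiableAt (by simp)).hasFDerivAt
  have h2 : HasFDerivAt F ((fderiv ℝ F 0).comp (-ContinuousLinearMap.id ℝ E)) 0 := by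
    have h3 : HasFDerivAt F (fderiv ℝ F 0) (-(0 : E)) := by simpa using h1
    have h4 := h3.comp (0 : E) (hasFDerivAt_id (𝕜 := ℝ) (0 : E)).neg
    refine h4.congr_of_eventuallyEq ?_
    filter_upwards [ball_mem_nhds (0 : E) hc] with x hx using (he x hx).symm
  have h5 := h1.unique h2
  ext v
  have h6 := congrArg (fun L : E →L[ℝ] ℝ => L v) h5
  simp at h6
  simp
  linarith

end Scaling

/-- The passage from profiles to error classes: a weight of degree n in the parameters times a
profile vanishing to order k at q/r gives (m + |a|)^{n+k} / r^k. The condition 1 < c R₀ puts q/r in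
a closed ball strictly inside the domain of F. -/
theorem isKerrO_of_scaling {E : Type} [NormedAddCommGroup E] [NormedSpace ℝ E]
    {F : E → ℝ} {c R₀ : ℝ} {k n : ℕ} (hR : 0 < R₀) (hcR : 1 < c * R₀)
    (hF : ContDiffOn ℝ ∞ F (ball 0 c))
    (hb : ∀ l, ∃ C, 0 ≤ C ∧ ∀ x ∈ closedBall (0 : E) R₀⁻¹, ‖scaledDeriv F l x‖ ≤ C * ‖x‖ ^ k)
    {w : ℝ → ℝ → ℝ} (hw : ∀ m a, 0 ≤ m → |w m a| ≤ (m + |a|) ^ n)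
    {q : ℝ → ℝ → E} (hq : ∀ m a, 0 ≤ m → ‖q m a‖ ≤ m + |a|)
    {X : ℝ → ℝ → ℝ → ℝ} (hX : ∀ m a r, 0 ≤ m → R₀ * (m + |a|) < r →
      X m a r = w m a * F (r⁻¹ • q m a)) : IsKerrO R₀ (n + k) k X := by
  have hpos : ∀ m a r : ℝ, 0 ≤ m → R₀ * (m + |a|) < r → 0 < r := fun m a r hm h =>
    lt_of_le_of_lt (by positivity) h
  have hlt : ∀ m a r : ℝ, 0 ≤ m → R₀ * (m + |a|) < r → ‖q m a‖ < R₀⁻¹ * r := fun m a r hm h => by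
    rw [inv_mul_eq_div, lt_div_iff₀ hR]
    nlinarith [hq m a hm]
  have hRc : R₀⁻¹ < c := by rwa [inv_lt_iff_one_lt_mul₀ hR]
  refine ⟨fun m a hm => ?_, fun l => ?_⟩
  · have h1 : ContDiffOn ℝ ∞ (fun r => w m a * F (r⁻¹ • q m a)) (Ioi (R₀ * (m + |a|))) := by
      refine contDiffOn_const.mul (hF.comp (f := fun r : ℝ => r⁻¹ • q m a) ?_ ?_)
      · exact (contDiffOn_id.inv fun r hr => (hpos m a r hm hr).ne').smul contDiffOn_const
      · intro r hr
        simpa using (norm_inv_smul_lt (hpos m a r hm hr) (hlt m a r hm hr)).trans hRc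
    exact h1.congr fun r hr => hX m a r hm hr
  · obtain ⟨C, hC0, hC⟩ := hb l
    refine ⟨C, fun m a r hm hr => ?_⟩
    have hr0 := hpos m a r hm hr
    have hev : X m a =ᶠ[𝓝 r] fun r => w m a * F (r⁻¹ • q m a) := by
      filter_upwards [Ioi_mem_nhds hr] with s hs using hX m a s hm hs
    rw [hev.iteratedDeriv_eq l]
    have hball := norm_inv_smul_lt hr0 (hlt m a r hm hr)
    have hlt' : ‖q m a‖ < c * r := (hlt m a r hm hr).trans (by gcongr)
    have hsm : ContDiffAt ℝ l (fun r : ℝ => F (r⁻¹ • q m a)) r := by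
      have h2 : ContDiffAt ℝ ∞ F (r⁻¹ • q m a) := hF.contDiffAt (isOpen_ball.mem_nhds (by
        simpa using hball.trans hRc))
      refine (ContDiffAt.comp (f := fun r : ℝ => r⁻¹ • q m a) r h2 ?_).of_le
        (by exact_mod_cast le_top)
      exact (contDiffAt_id.inv hr0.ne').smul contDiffAt_const
    rw [iteratedDeriv_const_mul_field, iteratedDeriv_comp_inv_smul hF (q m a) l hr0 hlt']
    have h3 := hC (r⁻¹ • q m a) (by simpa using hball.le)
    have h4 : ‖r⁻¹ • q m a‖ ≤ (m + |a|) / r := by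
      rw [norm_smul, norm_inv, Real.norm_of_nonneg hr0.le, inv_mul_eq_div]
      exact div_le_div_of_nonneg_right (hq m a hm) hr0.le
    have hma : 0 ≤ m + |a| := by positivity
    rw [abs_mul, abs_mul, abs_of_pos (by positivity : 0 < (r ^ l)⁻¹)]
    calc |w m a| * ((r ^ l)⁻¹ * |scaledDeriv F l (r⁻¹ • q m a)|)
        ≤ (m + |a|) ^ n * ((r ^ l)⁻¹ * (C * ((m + |a|) / r) ^ k)) := by
          gcongr
          · exact hw m a hm
          · exact h3.trans (by gcongr)
      _ = C * (m + |a|) ^ (n + k) / r ^ (k + l) := by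
          rw [div_pow, pow_add, pow_add]; field_simp

theorem isKerrO_of_eq_zero {R₀ : ℝ} {p q : ℕ} {X : ℝ → ℝ → ℝ → ℝ}
    (hX : ∀ m a r, 0 ≤ m → R₀ * (m + |a|) < r → X m a r = 0) : IsKerrO R₀ p q X := by
  refine ⟨fun m a hm => contDiffOn_const.congr fun r hr => hX m a r hm hr, fun l => ⟨0, ?_⟩⟩
  intro m a r hm hr
  have hev : X m a =ᶠ[𝓝 r] fun _ => 0 := by
    filter_upwards [Ioi_mem_nhds hr] with s hs using hX m a s hm hs
  rw [hev.iteratedDeriv_eq l]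
  simp

/-! ### Symmetries and moments of the surface measure of the unit sphere. -/

/-- The surface measure of the unit sphere. -/
abbrev sphereMeasure : Measure (sphere (0 : Space) 1) :=
  (volume : Measure Space).toSphere

/-- The homeomorphism of the unit sphere induced by a linear isometry. -/
def sphereHomeomorph (A : Space ≃ₗᵢ[ℝ] Space) : sphere (0 : Space) 1 ≃ₜ sphere (0 : Space) 1 where
  toFun w := ⟨A w, by simp⟩
  invFun w := ⟨A.symm w, by simp⟩
  left_inv w := by ext; simp
  right_inv w := by ext; simp
  continuous_toFun := by fun_prop
  continuous_invFun := by fun_prop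

/-- Surface measure is, up to the dimension factor, the volume of the cone over a set. A linear
isometry maps cones to cones and preserves volume. -/
theorem map_sphereHomeomorph (A : Space ≃ₗᵢ[ℝ] Space) :
    sphereMeasure.map (sphereHomeomorph A) = sphereMeasure := by
  ext s hs
  rw [Measure.map_apply (sphereHomeomorph A).continuous.measurable hs,
    Measure.toSphere_apply' _ hs,
    Measure.toSphere_apply' _ ((sphereHomeomorph A).continuous.measurable hs)]
  congr 1
  have h1 : Ioo (0 : ℝ) 1 • (Subtype.val '' (sphereHomeomorph A ⁻¹' s))
      = A ⁻¹' (Ioo (0 : ℝ) 1 • (Subtype.val '' s)) := by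
    ext x
    simp only [Set.mem_smul, mem_image, mem_preimage]
    constructor
    · rintro ⟨t, ht, _, ⟨w, hw, rfl⟩, rfl⟩
      exact ⟨t, ht, _, ⟨_, hw, rfl⟩, by simp [sphereHomeomorph]⟩
    · rintro ⟨t, ht, _, ⟨w, hw, rfl⟩, hx⟩
      refine ⟨t, ht, _, ⟨(sphereHomeomorph A).symm w, by simpa using hw, rfl⟩, ?_⟩
      apply A.injective
      rw [← hx, map_smul]
      congr 1
      simp [sphereHomeomorph]
  rw [h1]
  exact A.measurePreserving.measure_preimage_equiv (f := A.toMeasurableEquiv) _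

theorem integral_sphere_comp (A : Space ≃ₗᵢ[ℝ] Space) (f : Space → ℝ) :
    ∫ w : sphere (0 : Space) 1, f (A w) ∂sphereMeasure = ∫ w, f w ∂sphereMeasure := by
  conv_rhs => rw [← map_sphereHomeomorph A]
  rw [(sphereHomeomorph A).measurableEmbedding.integral_map]
  rfl

/-- The diagonal isometry with entries `s i = ± 1`. -/
def signIsometry (s : Fin 3 → ℝ) (hs : ∀ i, s i * s i = 1) : Space ≃ₗᵢ[ℝ] Space where
  toFun x := WithLp.toLp 2 fun i => s i * x i
  invFun x := WithLp.toLp 2 fun i => s i * x i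
  map_add' x y := by ext i; simp [mul_add]
  map_smul' c x := by ext i; simp; ring
  left_inv x := by ext i; simp [← mul_assoc, hs]
  right_inv x := by ext i; simp [← mul_assoc, hs]
  norm_map' x := by
    simp only [EuclideanSpace.norm_eq]
    congr 1
    refine Finset.sum_congr rfl fun i _ => ?_
    have : s i ^ 2 = 1 := by rw [sq]; exact hs i
    simp [mul_pow, this]

@[simp] theorem signIsometry_apply (s : Fin 3 → ℝ) (hs : ∀ i, s i * s i = 1) (x : Space)
    (i : Fin 3) : signIsometry s hs x i = s i * x i := rfl

theorem sphereMeasure_real_univ : sphereMeasure.real univ = 4 * Real.pi := by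
  rw [Measure.toSphere_real_apply_univ, Measure.real, EuclideanSpace.volume_ball_fin_three]
  have h : 0 ≤ Real.pi * (4 / 3) := by positivity
  simp only [finrank_euclideanSpace, Fintype.card_fin, one_pow, ENNReal.ofReal_one, one_mul]
  rw [show Real.pi * 4 / 3 = Real.pi * (4 / 3) by ring, ENNReal.toReal_ofReal h]
  push_cast
  ring

theorem norm_sq_eq (x : Space) : ‖x‖ ^ 2 = x 0 ^ 2 + x 1 ^ 2 + x 2 ^ 2 := by
  rw [EuclideanSpace.norm_sq_eq, Fin.sum_univ_three]; simp

theorem norm_sq_sphere (w : sphere (0 : Space) 1) :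
    (w : Space) 0 ^ 2 + (w : Space) 1 ^ 2 + (w : Space) 2 ^ 2 = 1 := by
  rw [← norm_sq_eq]; simp

theorem integrable_sphere {f : Space → ℝ} (hf : Continuous f) :
    Integrable (fun w : sphere (0 : Space) 1 => f w) sphereMeasure :=
  (hf.comp continuous_subtype_val).integrable_of_hasCompactSupport
    (HasCompactSupport.of_compactSpace _)

/-- Coordinate swaps make the three second moments equal, and their sum is the total area 4π. -/
theorem integral_sphere_coord_sq (i : Fin 3) :
    ∫ w : sphere (0 : Space) 1, (w : Space) i ^ 2 ∂sphereMeasure = 4 * Real.pi / 3 := by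
  have h1 : ∀ i : Fin 3, ∫ w : sphere (0 : Space) 1, (w : Space) i ^ 2 ∂sphereMeasure
      = ∫ w : sphere (0 : Space) 1, (w : Space) 0 ^ 2 ∂sphereMeasure := fun i => by
    rw [← integral_sphere_comp (LinearIsometryEquiv.piLpCongrLeft 2 ℝ ℝ (Equiv.swap 0 i))
      (fun x => x i ^ 2)]
    simp [LinearIsometryEquiv.piLpCongrLeft_apply, Equiv.piCongrLeft'_apply]
  have h2 : ∫ w : sphere (0 : Space) 1, ((w : Space) 0 ^ 2 + (w : Space) 1 ^ 2 + (w : Space) 2 ^ 2)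
      ∂sphereMeasure = 4 * Real.pi := by
    simp_rw [norm_sq_sphere]
    rw [integral_const, sphereMeasure_real_univ]
    simp
  have hi : ∀ i : Fin 3, Integrable (fun w : sphere (0 : Space) 1 => (w : Space) i ^ 2)
      sphereMeasure := fun i => integrable_sphere (f := fun x => x i ^ 2) (by fun_prop)
  rw [integral_add (f := fun w : sphere (0 : Space) 1 => (w : Space) 0 ^ 2 + (w : Space) 1 ^ 2)
    ((hi 0).add (hi 1)) (hi 2), integral_add (hi 0) (hi 1), h1 1, h1 2] at h2
  rw [h1 i]
  linarith

theorem integral_sphere_eq_zero_of_odd (A : Space ≃ₗᵢ[ℝ] Space) {f : Space → ℝ}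
    (hf : ∀ w : sphere (0 : Space) 1, f (A w) = -f w) :
    ∫ w : sphere (0 : Space) 1, f w ∂sphereMeasure = 0 := by
  have h := integral_sphere_comp A f
  simp_rw [hf] at h
  rw [integral_neg] at h
  linarith

/-! ### Coordinate derivatives under linear symmetries. -/

theorem sum_mul_pd (f : Space → ℝ) (x : Space) (v : Fin 3 → ℝ) :
    ∑ i, v i * pd i f x = fderiv ℝ f x (WithLp.toLp 2 v) := by
  have h : (WithLp.toLp 2 v : Space) = ∑ i, v i • EuclideanSpace.single i (1 : ℝ) := by
    ext j; simp [Pi.single_apply]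
  rw [h, map_sum]
  simp [pd]

theorem sum_coord_mul_pd (f : Space → ℝ) (x : Space) : ∑ i, x i * pd i f x = fderiv ℝ f x x :=
  sum_mul_pd f x x

theorem pd_const_mul (c : ℝ) (f : Space → ℝ) (i : Fin 3) (x : Space) :
    pd i (fun y => c * f y) x = c * pd i f x := by
  unfold pd
  rw [show (fun y => c * f y) = c • f from rfl, fderiv_const_smul_field]
  rfl

theorem pd_const_add (c : ℝ) (f : Space → ℝ) (i : Fin 3) (x : Space) :
    pd i (fun y => c + f y) x = pd i f x := by
  unfold pd
  rw [fderiv_const_add]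

theorem pd_mul {f g : Space → ℝ} {x : Space} (hf : DifferentiableAt ℝ f x)
    (hg : DifferentiableAt ℝ g x) (i : Fin 3) :
    pd i (fun y => f y * g y) x = pd i f x * g x + f x * pd i g x := by
  unfold pd
  rw [fderiv_fun_mul hf hg]
  simp
  ring

theorem pd_sum {f : Fin 3 → Space → ℝ} {x : Space} (hf : ∀ j, DifferentiableAt ℝ (f j) x)
    (i : Fin 3) : pd i (fun y => ∑ j, f j y) x = ∑ j, pd i (f j) x := by
  unfold pd
  rw [fderiv_fun_sum fun j _ => hf j]
  simp

theorem pd_coord (i j : Fin 3) (x : Space) : pd i (fun y => y j) x = if j = i then 1 else 0 := by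
  unfold pd
  have h : HasFDerivAt (fun y : Space => y j) (EuclideanSpace.proj j : Space →L[ℝ] ℝ) x :=
    (EuclideanSpace.proj j : Space →L[ℝ] ℝ).hasFDerivAt
  rw [h.fderiv]
  simp

theorem differentiableAt_coord (j : Fin 3) (x : Space) :
    DifferentiableAt ℝ (fun y : Space => y j) x :=
  (EuclideanSpace.proj j : Space →L[ℝ] ℝ).differentiableAt

theorem pd_congr {f g : Space → ℝ} {x : Space} (h : f =ᶠ[𝓝 x] g) (i : Fin 3) :
    pd i f x = pd i g x := by
  unfold pd; rw [h.fderiv_eq]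

/-- Partial derivatives of a function with a symmetry under a linear map that has the
coordinate vectors as eigenvectors. -/
theorem pd_equivariant (A : Space ≃L[ℝ] Space) {f g : Space → ℝ} {t : ℝ}
    (h : ∀ y, f (A y) = t * g y) {i : Fin 3} {c : ℝ}
    (hA : A (EuclideanSpace.single i 1) = c • EuclideanSpace.single i 1) (x : Space) :
    c * pd i f (A x) = t * pd i g x := by
  rw [← pd_const_mul t, ← funext h]
  unfold pd
  have := A.comp_right_fderiv (f := f) (x := x)
  rw [show (fun y => f (A y)) = f ∘ A from rfl, this]
  simp [hA]

/-- Two functions `f` and `g` are needed because the dilation also changes the rotation parameter.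
-/
theorem pd_smul_of_homogeneous {f g : Space → ℝ} {c t : ℝ} (hc : c ≠ 0)
    (h : ∀ y, f (c • y) = t * g y) (i : Fin 3) (x : Space) :
    pd i f (c • x) = c⁻¹ * t * pd i g x := by
  have := pd_equivariant (ContinuousLinearEquiv.smulLeft (Units.mk0 c hc)) (f := f) (g := g)
    (t := t) (c := c) (i := i) h rfl x
  rw [mul_assoc, ← this, inv_mul_cancel_left₀ hc]
  rfl

theorem pd_signIsometry {s : Fin 3 → ℝ} (hs : ∀ i, s i * s i = 1) {f g : Space → ℝ} {t : ℝ}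
    (h : ∀ y, f (signIsometry s hs y) = t * g y) (i : Fin 3) (x : Space) :
    pd i f (signIsometry s hs x) = s i * t * pd i g x := by
  have := pd_equivariant (signIsometry s hs).toContinuousLinearEquiv (f := f) (g := g)
    (t := t) (c := s i) (i := i) h (by
      ext j
      by_cases hj : j = i
      · subst hj; simp
      · simp [hj]) x
  rw [mul_assoc, ← this, ← mul_assoc, hs, one_mul]
  rfl

theorem contDiffAt_pd {P : Type} [NormedAddCommGroup P] [NormedSpace ℝ P]
    {f : P → Space → ℝ} {p : P × Space}
    (hf : ContDiffAt ℝ ∞ (fun q : P × Space => f q.1 q.2) p) (i : Fin 3) :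
    ContDiffAt ℝ ∞ (fun q : P × Space => pd i (f q.1) q.2) p := by
  unfold pd
  refine ContDiffAt.clm_apply ?_ contDiffAt_const
  refine ContDiffAt.fderiv (n := ∞) (f := fun (q : P × Space) y => f q.1 y)
    (g := fun q : P × Space => q.2) ?_ contDiffAt_snd (by simp)
  exact ContDiffAt.comp (f := fun q : (P × Space) × Space => (q.1.1, q.2)) (p, p.2) hf
    (by fun_prop)

/-- Euler's identity, from differentiating f(t x) = f(x)/t at t = 1. -/
theorem fderiv_self_of_homogeneous_neg_one {f : Space → ℝ} {x : Space}
    (hf : DifferentiableAt ℝ f x) (h : ∀ c : ℝ, 0 < c → f (c • x) = c⁻¹ * f x) :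
    fderiv ℝ f x x = -f x := by
  have h0 : HasDerivAt (fun t : ℝ => t • x) x 1 := by
    simpa using (hasDerivAt_id (1 : ℝ)).smul_const x
  have h1 : HasFDerivAt f (fderiv ℝ f x) ((1 : ℝ) • x) := by simpa using hf.hasFDerivAt
  have h2 := h1.comp_hasDerivAt (1 : ℝ) h0
  have h3 : HasDerivAt (fun t : ℝ => t⁻¹ * f x) (-f x) 1 := by
    simpa using (hasDerivAt_inv (one_ne_zero (α := ℝ))).mul_const (f x)
  refine h2.unique (h3.congr_of_eventuallyEq ?_)
  filter_upwards [Ioi_mem_nhds (zero_lt_one (α := ℝ))] with t ht using h t ht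

/-- A function invariant under rotations about the `z`-axis is annihilated by `e_z × x`. -/
theorem fderiv_rotation_of_axisymmetric {f : Space → ℝ} {x : Space}
    (hf : DifferentiableAt ℝ f x)
    (h : ∀ y : Space, y 0 ^ 2 + y 1 ^ 2 = x 0 ^ 2 + x 1 ^ 2 → y 2 = x 2 → f y = f x) :
    fderiv ℝ f x (WithLp.toLp 2 ![-x 1, x 0, 0]) = 0 := by
  -- The orbit of `x` under rotation about the z-axis; the last summand keeps the height constant.
  set γ : ℝ → Space := fun t => Real.cos t • x + Real.sin t • WithLp.toLp 2 ![-x 1, x 0, 0]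
    + (1 - Real.cos t) • WithLp.toLp 2 ![0, 0, x 2] with hγ
  have h0 : γ 0 = x := by simp [hγ]
  have h1 : HasDerivAt γ (WithLp.toLp 2 ![-x 1, x 0, 0]) 0 := by
    have := (((Real.hasDerivAt_cos 0).smul_const x).add ((Real.hasDerivAt_sin 0).smul_const
      (WithLp.toLp 2 ![-x 1, x 0, 0] : Space))).add
      (((Real.hasDerivAt_cos 0).const_sub 1).smul_const (WithLp.toLp 2 ![0, 0, x 2] : Space))
    refine this.congr_deriv ?_
    simp
  have h2 : HasFDerivAt f (fderiv ℝ f x) (γ 0) := by rw [h0]; exact hf.hasFDerivAt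
  have h3 := h2.comp_hasDerivAt (0 : ℝ) h1
  have h4 : f ∘ γ = fun _ => f x := by
    funext t
    refine h _ ?_ ?_
    · simp [hγ]
      linear_combination (x 0 ^ 2 + x 1 ^ 2) * Real.sin_sq_add_cos_sq t
    · simp [hγ]
      ring
  rw [h4] at h3
  exact h3.unique (hasDerivAt_const _ _)

/-! ### The Kerr-Schild functions on three-space -/

def ksRadius (a : ℝ) (x : Space) : ℝ := kerrRadius a (x 0) (x 1) (x 2)

/-- The mass-normalized profile `ρ³ / (ρ⁴ + a² z²)`. -/
def ksProfile (a : ℝ) (x : Space) : ℝ :=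
  ksRadius a x ^ 3 / (ksRadius a x ^ 4 + a ^ 2 * x 2 ^ 2)

/-- The spatial part of the null covector. -/
def ksCovector (a : ℝ) (i : Fin 3) (x : Space) : ℝ :=
  ![(ksRadius a x * x 0 + a * x 1) / (ksRadius a x ^ 2 + a ^ 2),
    (ksRadius a x * x 1 - a * x 0) / (ksRadius a x ^ 2 + a ^ 2), x 2 / ksRadius a x] i

/-- The weight `(x² + y²) / (ρ² + a²)`. -/
def ksWeight (a : ℝ) (x : Space) : ℝ := (x 0 ^ 2 + x 1 ^ 2) / (ksRadius a x ^ 2 + a ^ 2)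

theorem sq_lt_of_abs_lt_norm {a : ℝ} {x : Space} (h : |a| < ‖x‖) :
    a ^ 2 < x 0 ^ 2 + x 1 ^ 2 + x 2 ^ 2 := by
  rw [← norm_sq_eq, ← sq_abs]
  exact pow_lt_pow_left₀ h (abs_nonneg a) two_ne_zero

theorem ksRadius_pos {a : ℝ} {x : Space} (h : |a| < ‖x‖) : 0 < ksRadius a x :=
  kerrRadius_pos (sq_lt_of_abs_lt_norm h)

theorem ksRadius_equation {a : ℝ} {x : Space} (h : |a| < ‖x‖) :
    (x 0 ^ 2 + x 1 ^ 2) / (ksRadius a x ^ 2 + a ^ 2) + x 2 ^ 2 / ksRadius a x ^ 2 = 1 :=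
  (eq_kerrRadius_iff (sq_lt_of_abs_lt_norm h) (ksRadius_pos h)).2 rfl

theorem norm_sq_sub_le_ksRadius_sq {a : ℝ} {x : Space} (h : |a| < ‖x‖) :
    ‖x‖ ^ 2 - a ^ 2 ≤ ksRadius a x ^ 2 := by
  have h1 := sq_lt_of_abs_lt_norm h
  have h2 := Real.abs_le_sqrt (show (x 0 ^ 2 + x 1 ^ 2 + x 2 ^ 2 - a ^ 2) ^ 2 ≤
    (x 0 ^ 2 + x 1 ^ 2 + x 2 ^ 2 - a ^ 2) ^ 2 + 4 * a ^ 2 * x 2 ^ 2 by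
      nlinarith [sq_nonneg (a * x 2)])
  have h3 := le_abs_self (x 0 ^ 2 + x 1 ^ 2 + x 2 ^ 2 - a ^ 2)
  rw [norm_sq_eq, ksRadius, kerrRadius, Real.sq_sqrt (by linarith)]
  linarith

/-- Smoothness is joint in (a, x), because a/r is later the variable of the expansion. Both
radicands are positive once |a| < |x|. -/
theorem contDiffAt_ksRadius {p : ℝ × Space} (h : |p.1| < ‖p.2‖) :
    ContDiffAt ℝ ∞ (fun q : ℝ × Space => ksRadius q.1 q.2) p := by
  have h1 := sq_lt_of_abs_lt_norm h
  unfold ksRadius kerrRadius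
  have hx : ∀ i : Fin 3, ContDiffAt ℝ ∞ (fun q : ℝ × Space => q.2 i) p := fun i => by fun_prop
  have h2 : ContDiffAt ℝ ∞ (fun q : ℝ × Space =>
      q.2 0 ^ 2 + q.2 1 ^ 2 + q.2 2 ^ 2 - q.1 ^ 2) p :=
    ((((hx 0).pow 2).add ((hx 1).pow 2)).add ((hx 2).pow 2)).sub (contDiffAt_fst.pow 2)
  refine ContDiffAt.sqrt ((h2.add (ContDiffAt.sqrt ((h2.pow 2).add
    ((contDiffAt_const.mul (contDiffAt_fst.pow 2)).mul ((hx 2).pow 2))) ?_)).div_const 2) ?_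
  · have : 0 < (p.2 0 ^ 2 + p.2 1 ^ 2 + p.2 2 ^ 2 - p.1 ^ 2) ^ 2 := by
      apply pow_pos; linarith
    have h3 : 0 ≤ 4 * p.1 ^ 2 * p.2 2 ^ 2 := by positivity
    exact (by linarith : (0 : ℝ) < _).ne'
  · have h3 := Real.sqrt_nonneg ((p.2 0 ^ 2 + p.2 1 ^ 2 + p.2 2 ^ 2 - p.1 ^ 2) ^ 2
      + 4 * p.1 ^ 2 * p.2 2 ^ 2)
    exact (by linarith : (0 : ℝ) < _).ne'

theorem ksProfile_denom_pos {a : ℝ} {x : Space} (h : |a| < ‖x‖) :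
    0 < ksRadius a x ^ 4 + a ^ 2 * x 2 ^ 2 := by
  have := ksRadius_pos h
  positivity

theorem ksProfile_pos {a : ℝ} {x : Space} (h : |a| < ‖x‖) : 0 < ksProfile a x :=
  div_pos (pow_pos (ksRadius_pos h) 3) (ksProfile_denom_pos h)

theorem contDiffAt_ksProfile {p : ℝ × Space} (h : |p.1| < ‖p.2‖) :
    ContDiffAt ℝ ∞ (fun q : ℝ × Space => ksProfile q.1 q.2) p := by
  have hρ := contDiffAt_ksRadius h
  refine (hρ.pow 3).div ((hρ.pow 4).add (by fun_prop)) (ksProfile_denom_pos h).ne'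

theorem contDiffAt_ksWeight {p : ℝ × Space} (h : |p.1| < ‖p.2‖) :
    ContDiffAt ℝ ∞ (fun q : ℝ × Space => ksWeight q.1 q.2) p := by
  have hρ := contDiffAt_ksRadius h
  have := ksRadius_pos h
  exact ContDiffAt.div (by fun_prop) ((hρ.pow 2).add (by fun_prop))
    (by positivity : (0 : ℝ) < ksRadius p.1 p.2 ^ 2 + p.1 ^ 2).ne'

theorem contDiffAt_ksCovector {p : ℝ × Space} (h : |p.1| < ‖p.2‖) (i : Fin 3) :
    ContDiffAt ℝ ∞ (fun q : ℝ × Space => ksCovector q.1 i q.2) p := by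
  have hρ := contDiffAt_ksRadius h
  have hpos := ksRadius_pos h
  have hd : ksRadius p.1 p.2 ^ 2 + p.1 ^ 2 ≠ 0 := by positivity
  have hd' : ContDiffAt ℝ ∞ (fun q : ℝ × Space => ksRadius q.1 q.2 ^ 2 + q.1 ^ 2) p :=
    (hρ.pow 2).add (by fun_prop)
  fin_cases i
  · exact ((hρ.mul (by fun_prop)).add (by fun_prop)).div hd' hd
  · exact ((hρ.mul (by fun_prop)).sub (by fun_prop)).div hd' hd
  · exact ContDiffAt.div (by fun_prop) hρ hpos.ne'

/-- Restriction of a jointly smooth function to a fixed parameter. -/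
theorem contDiffAt_slice {P : Type} [NormedAddCommGroup P] [NormedSpace ℝ P]
    {f : P → Space → ℝ} {a : P} {x : Space}
    (h : ContDiffAt ℝ ∞ (fun q : P × Space => f q.1 q.2) (a, x)) : ContDiffAt ℝ ∞ (f a) x :=
  ContDiffAt.comp (f := fun y : Space => (a, y)) x h (by fun_prop)

theorem sum_ksCovector_sq {a : ℝ} {x : Space} (h : |a| < ‖x‖) :
    ∑ i, ksCovector a i x ^ 2 = 1 := by
  have hpos := ksRadius_pos h
  have hd : ksRadius a x ^ 2 + a ^ 2 ≠ 0 := by positivity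
  rw [← ksRadius_equation h, Fin.sum_univ_three]
  simp [ksCovector]
  field_simp
  ring

theorem sum_ksCovector_mul_coord {a : ℝ} {x : Space} (h : |a| < ‖x‖) :
    ∑ i, ksCovector a i x * x i = ksRadius a x := by
  have hpos := ksRadius_pos h
  have hd : ksRadius a x ^ 2 + a ^ 2 ≠ 0 := by positivity
  have h1 : ksRadius a x = ksRadius a x * ((x 0 ^ 2 + x 1 ^ 2) / (ksRadius a x ^ 2 + a ^ 2)
    + x 2 ^ 2 / ksRadius a x ^ 2) := by rw [ksRadius_equation h, mul_one]
  rw [h1, Fin.sum_univ_three]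
  simp [ksCovector]
  field_simp
  ring

/-- The rotational component of ℓ is proportional to a; this is the source of the factor a in J. -/
theorem sum_ksCovector_mul_rotation (a : ℝ) (x : Space) :
    ∑ i, ksCovector a i x * ![-x 1, x 0, 0] i = -a * ksWeight a x := by
  rw [Fin.sum_univ_three]
  simp [ksCovector, ksWeight]
  ring

/-- The explicit formula is homogeneous of degree one jointly in (a, x). The degrees of the profile
(-1), the weight (0) and the covector (0) follow from it. -/
theorem ksRadius_smul {c : ℝ} (hc : 0 < c) (a : ℝ) (x : Space) :
    ksRadius (c * a) (c • x) = c * ksRadius a x := by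
  simp only [ksRadius, kerrRadius, PiLp.smul_apply, smul_eq_mul]
  set b := x 0 ^ 2 + x 1 ^ 2 + x 2 ^ 2 - a ^ 2 with hb
  have h1 : (c * x 0) ^ 2 + (c * x 1) ^ 2 + (c * x 2) ^ 2 - (c * a) ^ 2 = c ^ 2 * b := by
    rw [hb]; ring
  rw [h1, show (c ^ 2 * b) ^ 2 + 4 * (c * a) ^ 2 * (c * x 2) ^ 2
    = (c ^ 2) ^ 2 * (b ^ 2 + 4 * a ^ 2 * x 2 ^ 2) by ring, Real.sqrt_mul (by positivity),
    Real.sqrt_sq (by positivity), ← mul_add, mul_div_assoc, Real.sqrt_mul (by positivity),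
    Real.sqrt_sq hc.le]

theorem ksProfile_smul {c : ℝ} (hc : 0 < c) (a : ℝ) (x : Space) :
    ksProfile (c * a) (c • x) = c⁻¹ * ksProfile a x := by
  simp only [ksProfile, ksRadius_smul hc, PiLp.smul_apply, smul_eq_mul]
  rw [show (c * ksRadius a x) ^ 4 + (c * a) ^ 2 * (c * x 2) ^ 2
    = c ^ 4 * (ksRadius a x ^ 4 + a ^ 2 * x 2 ^ 2) by ring]
  rw [← mul_div_mul_left (ksRadius a x ^ 3) _ (pow_pos hc 4).ne', ← mul_div_assoc]
  congr 1
  field_simp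

theorem ksWeight_smul {c : ℝ} (hc : 0 < c) (a : ℝ) (x : Space) :
    ksWeight (c * a) (c • x) = ksWeight a x := by
  simp only [ksWeight, ksRadius_smul hc, PiLp.smul_apply, smul_eq_mul]
  rw [← mul_div_mul_left (x 0 ^ 2 + x 1 ^ 2) _ (pow_pos hc 2).ne']
  congr 1 <;> ring

theorem ksCovector_smul {c : ℝ} (hc : 0 < c) (a : ℝ) (i : Fin 3) (x : Space) :
    ksCovector (c * a) i (c • x) = ksCovector a i x := by
  simp only [ksCovector, ksRadius_smul hc, PiLp.smul_apply, smul_eq_mul]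
  have h1 : (c * ksRadius a x * (c * x 0) + c * a * (c * x 1))
      / ((c * ksRadius a x) ^ 2 + (c * a) ^ 2)
      = (ksRadius a x * x 0 + a * x 1) / (ksRadius a x ^ 2 + a ^ 2) := by
    rw [← mul_div_mul_left _ (ksRadius a x ^ 2 + a ^ 2) (pow_pos hc 2).ne']
    congr 1 <;> ring
  have h2 : (c * ksRadius a x * (c * x 1) - c * a * (c * x 0))
      / ((c * ksRadius a x) ^ 2 + (c * a) ^ 2)
      = (ksRadius a x * x 1 - a * x 0) / (ksRadius a x ^ 2 + a ^ 2) := by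
    rw [← mul_div_mul_left _ (ksRadius a x ^ 2 + a ^ 2) (pow_pos hc 2).ne']
    congr 1 <;> ring
  rw [h1, h2, mul_div_mul_left _ _ hc.ne']


theorem sign_mul_sq {s : Fin 3 → ℝ} (hs : ∀ i, s i * s i = 1) (i : Fin 3) (t : ℝ) : (s i * t) ^ 2 = t ^ 2 := by
  rw [mul_pow, sq (s i), hs, one_mul]

theorem ksRadius_signIsometry {s : Fin 3 → ℝ} (hs : ∀ i, s i * s i = 1) (a : ℝ) (x : Space) :
    ksRadius (s 0 * s 1 * a) (signIsometry s hs x) = ksRadius a x := by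
  simp only [ksRadius, kerrRadius, signIsometry_apply, sign_mul_sq hs, mul_assoc]

theorem ksProfile_signIsometry {s : Fin 3 → ℝ} (hs : ∀ i, s i * s i = 1) (a : ℝ) (x : Space) :
    ksProfile (s 0 * s 1 * a) (signIsometry s hs x) = ksProfile a x := by
  have h1 : (s 0 * s 1 * a) ^ 2 = a ^ 2 := by rw [mul_assoc, sign_mul_sq hs, sign_mul_sq hs]
  simp only [ksProfile, ksRadius_signIsometry hs, signIsometry_apply, sign_mul_sq hs, h1]

/-- Reflecting exactly one of x and y reverses the sense of rotation, so a becomes s₀ s₁ a. The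
antipodal map, the half turn about z and the exchange of a with -a are all instances. -/
theorem ksCovector_signIsometry {s : Fin 3 → ℝ} (hs : ∀ i, s i * s i = 1) (a : ℝ) (i : Fin 3) (x : Space) :
    ksCovector (s 0 * s 1 * a) i (signIsometry s hs x) = s i * ksCovector a i x := by
  have h1 : (s 0 * s 1 * a) ^ 2 = a ^ 2 := by rw [mul_assoc, sign_mul_sq hs, sign_mul_sq hs]
  simp only [ksCovector, ksRadius_signIsometry hs, signIsometry_apply, h1]
  fin_cases i
  · simp
    rw [← mul_div_assoc]
    congr 1
    linear_combination (s 0 * a * x 1) * hs 1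
  · simp
    rw [← mul_div_assoc]
    congr 1
    linear_combination (-s 1 * a * x 0) * hs 0
  · exact mul_div_assoc _ _ _

theorem ksRadius_zero (x : Space) : ksRadius 0 x = ‖x‖ := by
  rw [ksRadius, kerrRadius, ← norm_sq_eq]
  simp

/-! ### Stationary Kerr-Schild metrics -/

/-- The projection of spacetime to its spatial coordinates. -/
def spatial : Spacetime →L[ℝ] Space :=
  LinearMap.toContinuousLinearMap
    { toFun := fun p => WithLp.toLp 2 ![p 1, p 2, p 3]
      map_add' := fun p q => by ext i; fin_cases i <;> simp
      map_smul' := fun c p => by ext i; fin_cases i <;> simp }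

theorem spatial_apply (p : Spacetime) : spatial p = WithLp.toLp 2 ![p 1, p 2, p 3] := rfl

theorem spatial_slice (x : Space) : spatial (slice x) = x := by
  ext i; fin_cases i <;> simp [spatial_apply, slice]

theorem spatial_single_zero : spatial (Pi.single 0 1) = 0 := by
  ext i; fin_cases i <;> simp [spatial_apply]

theorem spatial_single_succ (i : Fin 3) :
    spatial (Pi.single i.succ 1) = EuclideanSpace.single i 1 := by
  ext j; fin_cases i <;> fin_cases j <;> simp [spatial_apply]

theorem fderiv_comp_spatial {f : Space → ℝ} {p : Spacetime}
    (hf : DifferentiableAt ℝ f (spatial p)) (v : Spacetime) :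
    fderiv ℝ (fun q => f (spatial q)) p v = fderiv ℝ f (spatial p) (spatial v) := by
  rw [(hf.hasFDerivAt.comp p spatial.hasFDerivAt).fderiv (f := fun q => f (spatial q))]
  rfl

theorem spacetimePd_zero {f : Space → ℝ} {p : Spacetime}
    (hf : DifferentiableAt ℝ f (spatial p)) : spacetimePd 0 (fun q => f (spatial q)) p = 0 := by
  rw [spacetimePd, fderiv_comp_spatial hf, spatial_single_zero, map_zero]

theorem spacetimePd_succ {f : Space → ℝ} {p : Spacetime}
    (hf : DifferentiableAt ℝ f (spatial p)) (i : Fin 3) :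
    spacetimePd i.succ (fun q => f (spatial q)) p = pd i f (spatial p) := by
  rw [spacetimePd, fderiv_comp_spatial hf, spatial_single_succ, pd]

theorem spacetimePd_congr {f g : Spacetime → ℝ} {p : Spacetime} (h : f =ᶠ[𝓝 p] g) (i : Fin 4) :
    spacetimePd i f p = spacetimePd i g p := by
  unfold spacetimePd; rw [h.fderiv_eq]

/-- The covector `(c, l₁, l₂, l₃)`. -/
def consCovector (c : ℝ) (l : Fin 3 → ℝ) : Fin 4 → ℝ := Fin.cons c l

/-- The stationary metric `η + 2 h ℓ ⊗ ℓ` with `ℓ = (1, l₁, l₂, l₃)`. -/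
def ksMetric (h : Space → ℝ) (l : Fin 3 → Space → ℝ) (p : Spacetime) : Matrix (Fin 4) (Fin 4) ℝ :=
  minkowski + (2 * h (spatial p)) • Matrix.vecMulVec (consCovector 1 fun i => l i (spatial p))
    (consCovector 1 fun i => l i (spatial p))

/-- The covector ℓ is null for η, so the terms quadratic in h cancel and the inverse is linear in h,
with ℓ raised by η. -/
theorem ksMetric_inv_aux (h : ℝ) {l : Fin 3 → ℝ} (hl : ∑ i, l i ^ 2 = 1) :
    (minkowski + (2 * h) • Matrix.vecMulVec (consCovector 1 l) (consCovector 1 l))⁻¹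
      = minkowski - (2 * h) • Matrix.vecMulVec (consCovector (-1) l) (consCovector (-1) l) := by
  have h1 : minkowski * minkowski = 1 := by
    rw [minkowski, Matrix.diagonal_mul_diagonal, ← Matrix.diagonal_one]
    congr 1; ext i; fin_cases i <;> simp
  have h2 : minkowski *ᵥ consCovector (-1) l = consCovector 1 l := by
    ext i; rw [minkowski, Matrix.mulVec_diagonal]; fin_cases i <;> simp [consCovector] <;> rfl
  have h3 : consCovector 1 l ᵥ* minkowski = consCovector (-1) l := by
    ext i; rw [minkowski, Matrix.vecMul_diagonal]; fin_cases i <;> simp [consCovector] <;> rfl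
  have h4 : consCovector 1 l ⬝ᵥ consCovector (-1) l = 0 := by
    simp only [dotProduct, consCovector, Fin.sum_univ_succ (n := 3), Fin.cons_zero, Fin.cons_succ,
      ← sq, hl]
    norm_num
  apply Matrix.inv_eq_right_inv
  rw [add_mul, mul_sub, mul_sub, h1, Matrix.mul_smul, Matrix.mul_vecMulVec, h2, Matrix.smul_mul,
    Matrix.vecMulVec_mul, h3, Matrix.smul_mul, Matrix.mul_smul, Matrix.vecMulVec_mul_vecMulVec, h4]
  simp

/-- The time component `√(1 + 2h)` and the spatial components `-2 h lᵢ / √(1 + 2h)` of the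
unit normal. -/
theorem unitNormal_ksMetric {h : Space → ℝ} {l : Fin 3 → Space → ℝ} {p : Spacetime}
    (hl : ∑ i, l i (spatial p) ^ 2 = 1) (hh : 0 < 1 + 2 * h (spatial p)) :
    unitNormal (ksMetric h l) p 0 = √(1 + 2 * h (spatial p)) ∧
    ∀ i : Fin 3, unitNormal (ksMetric h l) p i.succ =
      -2 * (h (spatial p) * l i (spatial p)) * (√(1 + 2 * h (spatial p)))⁻¹ := by
  have hinv := ksMetric_inv_aux (h (spatial p)) hl
  have h00 : (ksMetric h l p)⁻¹ 0 0 = -(1 + 2 * h (spatial p)) := by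
    rw [ksMetric, hinv]
    simp [minkowski, Matrix.vecMulVec_apply, consCovector]
    ring
  have hi0 : ∀ i : Fin 3, (ksMetric h l p)⁻¹ i.succ 0 = 2 * (h (spatial p) * l i (spatial p)) := by
    intro i
    rw [ksMetric, hinv]
    simp [minkowski, Matrix.vecMulVec_apply, consCovector]
    ring
  have hN : ∀ μ, unitNormal (ksMetric h l) p μ
      = -(ksMetric h l p)⁻¹ μ 0 * (√(1 + 2 * h (spatial p)))⁻¹ := by
    intro μ
    rw [unitNormal, lapse, h00, neg_neg, Matrix.mulVec, dotProduct, Fin.sum_univ_four]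
    simp
  refine ⟨?_, fun i => ?_⟩
  · rw [hN, h00, neg_neg]
    have := Real.sqrt_pos.2 hh
    rw [← div_eq_mul_inv, div_eq_iff this.ne', Real.mul_self_sqrt hh.le]
  · rw [hN, hi0]; ring

/-- The second fundamental form of the slice `t = 0` of a stationary Kerr-Schild metric. -/
def ksSecondForm (h : Space → ℝ) (l : Fin 3 → Space → ℝ) (x : Space) (i j : Fin 3) : ℝ :=
  (√(1 + 2 * h x))⁻¹ * (pd i (fun y => h y * l j y) x + pd j (fun y => h y * l i y) x
    + 2 * h x * ∑ k, l k x * pd k (fun y => h y * (l i y * l j y)) x)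

theorem ksMetric_succ_succ (h : Space → ℝ) (l : Fin 3 → Space → ℝ) (p : Spacetime) (i j : Fin 3) :
    ksMetric h l p i.succ j.succ = (if i = j then 1 else 0)
      + 2 * (h (spatial p) * (l i (spatial p) * l j (spatial p))) := by
  have : (minkowski i.succ j.succ : ℝ) = if i = j then 1 else 0 := by
    fin_cases i <;> fin_cases j <;> simp [minkowski, Matrix.diagonal]
  simp only [ksMetric, Matrix.add_apply, this, Matrix.smul_apply, Matrix.vecMulVec_apply,
    consCovector, Fin.cons_succ, smul_eq_mul]
  ring

theorem ksMetric_zero_succ (h : Space → ℝ) (l : Fin 3 → Space → ℝ) (p : Spacetime) (j : Fin 3) :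
    ksMetric h l p 0 j.succ = 2 * (h (spatial p) * l j (spatial p)) := by
  simp [ksMetric, minkowski, Matrix.vecMulVec_apply, consCovector,
    Matrix.diagonal_apply_ne _ (Fin.succ_ne_zero j).symm]
  ring

theorem ksMetric_succ_zero (h : Space → ℝ) (l : Fin 3 → Space → ℝ) (p : Spacetime) (j : Fin 3) :
    ksMetric h l p j.succ 0 = 2 * (h (spatial p) * l j (spatial p)) := by
  simp [ksMetric, minkowski, Matrix.vecMulVec_apply, consCovector]
  ring

theorem inducedData_ksMetric_g (h : Space → ℝ) (l : Fin 3 → Space → ℝ) (x : Space) (i j : Fin 3) :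
    (inducedData (ksMetric h l)).g x i j
      = (if i = j then 1 else 0) + 2 * (h x * (l i x * l j x)) := by
  simp only [inducedData, Matrix.of_apply, ksMetric_succ_succ, spatial_slice]

theorem hasFDerivAt_sqrt_one_add {h : Space → ℝ} {x : Space} (hd : DifferentiableAt ℝ h x)
    (hh : 0 < 1 + 2 * h x) :
    HasFDerivAt (fun y => √(1 + 2 * h y)) ((√(1 + 2 * h x))⁻¹ • fderiv ℝ h x) x := by
  have h1 := ((hd.hasFDerivAt.const_mul 2).const_add 1).sqrt hh.ne'
  refine h1.congr_fderiv ?_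
  rw [smul_smul]
  congr 1
  field_simp

theorem inducedData_ksMetric_k {h : Space → ℝ} {l : Fin 3 → Space → ℝ} {x : Space}
    (hd : DifferentiableAt ℝ h x) (hld : ∀ i, DifferentiableAt ℝ (l i) x)
    (hl : ∀ᶠ y in 𝓝 x, ∑ i, l i y ^ 2 = 1) (hh : 0 < 1 + 2 * h x) (i j : Fin 3) :
    (inducedData (ksMetric h l)).k x i j = ksSecondForm h l x i j := by
  have hsp : spatial (slice x) = x := spatial_slice x
  -- The closed form of the unit normal has to hold on a neighbourhood, since its components are
  -- differentiated.
  have hev : ∀ᶠ p in 𝓝 (slice x), ∑ i, l i (spatial p) ^ 2 = 1 ∧ 0 < 1 + 2 * h (spatial p) := by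
    have hc : Tendsto spatial (𝓝 (slice x)) (𝓝 x) := by
      have := spatial.continuous.tendsto (slice x)
      rwa [hsp] at this
    have h2 : ∀ᶠ y in 𝓝 x, 0 < 1 + 2 * h y :=
      (continuousAt_const.add (continuousAt_const.mul hd.continuousAt)).eventually
      (lt_mem_nhds hh)
    exact hc.eventually (hl.and h2)
  have hn0 := hasFDerivAt_sqrt_one_add hd hh
  have hsq : √(1 + 2 * h x) ^ 2 = 1 + 2 * h x := Real.sq_sqrt hh.le
  have hspos : 0 < √(1 + 2 * h x) := Real.sqrt_pos.2 hh
  set r := (√(1 + 2 * h x))⁻¹ with hr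
  have hA : r ^ 2 * (1 + 2 * h x) - 1 = 0 := by
    rw [hr, inv_pow, hsq, inv_mul_cancel₀ hh.ne', sub_self]
  -- derivatives of the components of the unit normal
  have hn0d : ∀ i : Fin 3, spacetimePd i.succ (fun q => unitNormal (ksMetric h l) q 0) (slice x)
      = r * pd i h x := by
    intro i
    rw [spacetimePd_congr (g := fun q => (fun y => √(1 + 2 * h y)) (spatial q))
      (hev.mono fun p hp => (unitNormal_ksMetric hp.1 hp.2).1),
      spacetimePd_succ (f := fun y => √(1 + 2 * h y)) (by rw [hsp]; exact hn0.differentiableAt), hsp, pd, hn0.fderiv]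
    rfl
  have hm : ∀ k, HasFDerivAt (fun y => h y * l k y)
      (h x • fderiv ℝ (l k) x + l k x • fderiv ℝ h x) x := fun k =>
    hd.hasFDerivAt.fun_mul (hld k).hasFDerivAt
  have hinv : HasFDerivAt (fun y => (√(1 + 2 * h y))⁻¹) ((-r ^ 3) • fderiv ℝ h x) x := by
    refine ((hasDerivAt_inv hspos.ne').comp_hasFDerivAt x hn0).congr_fderiv ?_
    rw [smul_smul, ← inv_pow, ← hr]
    congr 1
    ring
  have hnk : ∀ k, HasFDerivAt (fun y => -2 * (h y * l k y) * (√(1 + 2 * h y))⁻¹) _ x := fun k =>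
    ((hm k).const_mul (-2)).fun_mul hinv
  have hnd : ∀ i k : Fin 3, spacetimePd i.succ
      (fun q => unitNormal (ksMetric h l) q k.succ) (slice x)
      = l k x * (-2 * pd i h x * r + 2 * h x * pd i h x * r ^ 3)
        + (-2 * h x * r) * pd i (l k) x := by
    intro i k
    rw [spacetimePd_congr (g := fun q => (fun y => -2 * (h y * l k y) * (√(1 + 2 * h y))⁻¹)
      (spatial q)) (hev.mono fun p hp => (unitNormal_ksMetric hp.1 hp.2).2 k),
      spacetimePd_succ (f := fun y => -2 * (h y * l k y) * (√(1 + 2 * h y))⁻¹)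
      (by rw [hsp]; exact (hnk k).differentiableAt), hsp, pd, (hnk k).fderiv]
    simp [pd, ← hr]
    ring
  have hgd : ∀ k : Fin 3, DifferentiableAt ℝ (fun y => h y * (l i y * l j y)) x :=
    fun k => hd.fun_mul ((hld i).fun_mul (hld j))
  have hG : ∀ k : Fin 3, spacetimePd k.succ (fun q => ksMetric h l q i.succ j.succ) (slice x)
      = 2 * pd k (fun y => h y * (l i y * l j y)) x := by
    intro k
    simp_rw [ksMetric_succ_succ]
    rw [spacetimePd_succ (f := fun y => (if i = j then 1 else 0) + 2 * (h y * (l i y * l j y)))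
      (by rw [hsp]; exact ((hgd k).const_mul 2).const_add _), hsp, pd_const_add, pd_const_mul]
  have hG0 : spacetimePd 0 (fun q => ksMetric h l q i.succ j.succ) (slice x) = 0 := by
    simp_rw [ksMetric_succ_succ]
    exact spacetimePd_zero (f := fun y => (if i = j then 1 else 0) + 2 * (h y * (l i y * l j y)))
      (by rw [hsp]; exact ((hgd 0).const_mul 2).const_add _)
  have hN := unitNormal_ksMetric (h := h) (l := l) (p := slice x) (by rw [hsp]; exact hl.self_of_nhds)
    (by rw [hsp]; exact hh)
  rw [hsp] at hN
  have hB : ∑ k, l k x ^ 2 = 1 := hl.self_of_nhds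
  -- Differentiating |l|² = 1; together with `hB` this collapses the contractions of the metric with
  -- the derivative of the normal.
  have hC : ∀ i, ∑ k, l k x * pd i (l k) x = 0 := by
    intro i
    have h1 : pd i (fun y => ∑ k, l k y * l k y) x = 0 := by
      rw [pd_congr (g := fun _ => 1) (hl.mono fun y hy => by simpa [sq] using hy)]
      simp [pd]
    rw [pd_sum fun k => (hld k).fun_mul (hld k)] at h1
    simp_rw [pd_mul (hld _) (hld _)] at h1
    rw [Finset.sum_congr rfl fun k _ => (by ring :
      pd i (l k) x * l k x + l k x * pd i (l k) x = 2 * (l k x * pd i (l k) x)),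
      ← Finset.mul_sum] at h1
    linarith
  have hX : ∀ i j : Fin 3, ∑ k : Fin 3, ksMetric h l (slice x) k.succ j.succ
      * spacetimePd i.succ (fun q => unitNormal (ksMetric h l) q k.succ) (slice x)
      = l j x * (-2 * pd i h x * r + 2 * h x * pd i h x * r ^ 3) * (1 + 2 * h x)
        + (-2 * h x * r) * pd i (l j) x := by
    intro i j
    have hBi := hB
    have hCi := hC i
    simp only [Fin.sum_univ_three] at hBi hCi
    have h1 : ∀ k : Fin 3, ksMetric h l (slice x) k.succ j.succ
      * spacetimePd i.succ (fun q => unitNormal (ksMetric h l) q k.succ) (slice x)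
      = (if k = j then (l k x * (-2 * pd i h x * r + 2 * h x * pd i h x * r ^ 3)
        + (-2 * h x * r) * pd i (l k) x) else 0) + 2 * (h x * (l k x * l j x)) *
        (l k x * (-2 * pd i h x * r + 2 * h x * pd i h x * r ^ 3)
        + (-2 * h x * r) * pd i (l k) x) := by
      intro k
      rw [ksMetric_succ_succ, hsp, hnd]
      split_ifs <;> ring
    simp_rw [h1]
    rw [Finset.sum_add_distrib, Finset.sum_ite_eq' Finset.univ j, if_pos (Finset.mem_univ _),
      Fin.sum_univ_three]
    linear_combination (2 * h x * l j x * (-2 * pd i h x * r + 2 * h x * pd i h x * r ^ 3)) * hBi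
      + (2 * h x * l j x * (-2 * h x * r)) * hCi
  have hX' : ∑ k : Fin 3, ksMetric h l (slice x) i.succ k.succ
      * spacetimePd j.succ (fun q => unitNormal (ksMetric h l) q k.succ) (slice x)
      = l i x * (-2 * pd j h x * r + 2 * h x * pd j h x * r ^ 3) * (1 + 2 * h x)
        + (-2 * h x * r) * pd j (l i) x := by
    rw [← hX j i]
    refine Finset.sum_congr rfl fun k _ => ?_
    rw [ksMetric_succ_succ, ksMetric_succ_succ]
    congr 1
    simp only [eq_comm (a := i), mul_comm (l i _)]
  have hY : ∑ k : Fin 3, unitNormal (ksMetric h l) (slice x) k.succ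
      * spacetimePd k.succ (fun q => ksMetric h l q i.succ j.succ) (slice x)
      = -4 * h x * r * ∑ k, l k x * pd k (fun y => h y * (l i y * l j y)) x := by
    rw [Finset.mul_sum]
    refine Finset.sum_congr rfl fun k _ => ?_
    rw [hN.2, hG]
    ring
  simp only [inducedData, Matrix.of_apply, lieDeriv]
  rw [Fin.sum_univ_succ, Finset.sum_add_distrib, Finset.sum_add_distrib, hX i j, hX', hY, hG0,
    hn0d, hn0d, ksMetric_zero_succ, ksMetric_succ_zero, hsp, ksSecondForm, ← hr,
    pd_mul hd (hld j), pd_mul hd (hld i)]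
  -- With r²(1 + 2h) = 1, the contributions of n⁰ and nᵏ combine to -2r (∂_i(h l_j) + ∂_j(h l_i)).
  linear_combination (-(2 * h x * r * l j x * pd i h x) / 2 - (2 * h x * r * l i x * pd j h x) / 2) * hA

/-- The angular momentum density of a stationary axisymmetric Kerr-Schild metric. -/
theorem sum_ksSecondForm_rotation {h R S : Space → ℝ} {l : Fin 3 → Space → ℝ} {x : Space}
    (hd : DifferentiableAt ℝ h x) (hld : ∀ i, DifferentiableAt ℝ (l i) x)
    (hl : ∑ i, l i x ^ 2 = 1)
    (hR : ∀ᶠ y in 𝓝 x, ∑ i, l i y * y i = R y)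
    (hS : ∀ᶠ y in 𝓝 x, ∑ i, l i y * ![-y 1, y 0, 0] i = S y)
    (hY : fderiv ℝ (fun y => h y * R y) x (WithLp.toLp 2 ![-x 1, x 0, 0]) = 0) :
    ∑ i, ∑ j, ksSecondForm h l x i j * ![-x 1, x 0, 0] i * x j
      = (√(1 + 2 * h x))⁻¹ * (∑ k, x k * pd k (fun y => h y * S y) x - 2 * (h x * S x)
        + 2 * h x * (∑ k, l k x * pd k (fun y => h y * S y * R y) x - h x * S x)) := by
  have hc := fun j => differentiableAt_coord j x
  have hb : ∀ i, DifferentiableAt ℝ (fun y => h y * l i y) x := fun i => hd.fun_mul (hld i)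
  have hT : ∀ i j, DifferentiableAt ℝ (fun y => h y * (l i y * l j y)) x := fun i j =>
    hd.fun_mul ((hld i).fun_mul (hld j))
  have hSx := hS.self_of_nhds
  simp only [Fin.sum_univ_three, Matrix.cons_val_zero, Matrix.cons_val_one, Matrix.cons_val_two,
    Matrix.head_cons, Matrix.tail_cons] at hSx
  -- The identities `e1`, `e2`, `e3` are product rules: contractions of derivatives of h l and h l⊗l
  -- with position and rotation field become derivatives of the scalars hR, hS, hSR, plus terms
  -- without derivatives.
  have e1 : ∀ k, pd k (fun y => h y * R y) x = ∑ j, (pd k (fun y => h y * l j y) x * x j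
      + h x * l j x * if j = k then 1 else 0) := by
    intro k
    rw [pd_congr (g := fun y => ∑ j, h y * l j y * y j) (hR.mono fun y hy => by
      simp only [← hy, Finset.mul_sum, mul_assoc]), pd_sum fun j => (hb j).fun_mul (hc j)]
    simp_rw [pd_mul (hb _) (hc _), pd_coord]
  have e2 : ∀ k, pd k (fun y => h y * S y) x
      = -(pd k (fun y => h y * l 0 y) x * x 1 + h x * l 0 x * if (1 : Fin 3) = k then 1 else 0)
        + (pd k (fun y => h y * l 1 y) x * x 0 + h x * l 1 x * if (0 : Fin 3) = k then 1 else 0) := by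
    intro k
    rw [pd_congr (g := fun y => (-1) * (h y * l 0 y * y 1) + h y * l 1 y * y 0)
      (hS.mono fun y hy => by simp only [← hy, Fin.sum_univ_three]; simp; ring)]
    have : pd k (fun y => (-1) * (h y * l 0 y * y 1) + h y * l 1 y * y 0) x
        = pd k (fun y => (-1) * (h y * l 0 y * y 1)) x + pd k (fun y => h y * l 1 y * y 0) x := by
      unfold pd
      rw [fderiv_fun_add (((hb 0).fun_mul (hc 1)).const_mul _) ((hb 1).fun_mul (hc 0))]
      rfl
    rw [this, pd_const_mul, pd_mul (hb _) (hc _), pd_mul (hb _) (hc _), pd_coord, pd_coord]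
    ring
  have e3 : ∀ k, pd k (fun y => h y * S y * R y) x
      = ∑ j, ((-(pd k (fun y => h y * (l 0 y * l j y)) x * x 1
          + h x * (l 0 x * l j x) * if (1 : Fin 3) = k then 1 else 0)
        + (pd k (fun y => h y * (l 1 y * l j y)) x * x 0
          + h x * (l 1 x * l j x) * if (0 : Fin 3) = k then 1 else 0)) * x j
        + (h x * (l 0 x * l j x) * (-x 1) + h x * (l 1 x * l j x) * x 0)
          * if j = k then 1 else 0) := by
    intro k
    have hW : ∀ j, DifferentiableAt ℝ (fun y => (-1) * (h y * (l 0 y * l j y) * y 1)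
        + h y * (l 1 y * l j y) * y 0) x := fun j =>
      (((hT 0 j).fun_mul (hc 1)).const_mul _).add ((hT 1 j).fun_mul (hc 0))
    rw [pd_congr (g := fun y => ∑ j, ((-1) * (h y * (l 0 y * l j y) * y 1)
        + h y * (l 1 y * l j y) * y 0) * y j)
      ((hS.and hR).mono fun y hy => by
        simp only [← hy.1, ← hy.2, Fin.sum_univ_three]; simp; ring),
      pd_sum fun j => (hW j).fun_mul (hc j)]
    refine Finset.sum_congr rfl fun j _ => ?_
    have : pd k (fun y => (-1) * (h y * (l 0 y * l j y) * y 1) + h y * (l 1 y * l j y) * y 0) x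
        = pd k (fun y => (-1) * (h y * (l 0 y * l j y) * y 1)) x
          + pd k (fun y => h y * (l 1 y * l j y) * y 0) x := by
      unfold pd
      rw [fderiv_fun_add (((hT 0 j).fun_mul (hc 1)).const_mul _) ((hT 1 j).fun_mul (hc 0))]
      rfl
    rw [pd_mul (hW j) (hc j), pd_coord, this, pd_const_mul, pd_mul (hT 0 j) (hc 1),
      pd_mul (hT 1 j) (hc 0), pd_coord, pd_coord]
    ring
  have e4 : ∑ k, ![-x 1, x 0, 0] k * pd k (fun y => h y * R y) x = 0 := by
    rw [sum_mul_pd, hY]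
  simp only [e1, e2, e3, Fin.sum_univ_three] at e4 ⊢
  simp only [ksSecondForm, Fin.sum_univ_three]
  simp at e4 ⊢
  rw [← hSx]
  rw [Fin.sum_univ_three] at hl
  -- The relation `e4` removes the angular derivative of hR. In the quadratic part, l_k l_i ∂_k Yⁱ
  -- vanishes by antisymmetry, and |l|² = 1 produces the last -hS.
  linear_combination (√(1 + 2 * h x))⁻¹ * e4
    + (√(1 + 2 * h x))⁻¹ * (2 * h x ^ 2 * (l 0 x * x 1 - l 1 x * x 0)) * hl

/-! ### The Kerr initial data -/

theorem kerrMetric_eq_ksMetric (m a : ℝ) :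
    kerrMetric m a = ksMetric (fun y => m * ksProfile a y) (ksCovector a) := by
  funext p
  have h1 : kerrEll a p = consCovector 1 fun i => ksCovector a i (spatial p) := by
    ext i; fin_cases i <;> rfl
  have h2 : kerrH m a p = m * ksProfile a (spatial p) := mul_div_assoc _ _ _
  rw [kerrMetric, ksMetric, h1, h2]

/-- The mass-normalized metric perturbation `(g - e) / m`. -/
def ksTensor (a : ℝ) (i j : Fin 3) (x : Space) : ℝ :=
  2 * (ksProfile a x * (ksCovector a i x * ksCovector a j x))

theorem kerrData_g (m a : ℝ) (x : Space) (i j : Fin 3) :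
    (kerrData m a).g x i j = (if i = j then 1 else 0) + m * ksTensor a i j x := by
  rw [kerrData, kerrMetric_eq_ksMetric, inducedData_ksMetric_g, ksTensor]
  ring

theorem eventually_far {a : ℝ} {x : Space} (h : |a| < ‖x‖) : ∀ᶠ y in 𝓝 x, |a| < ‖y‖ :=
  continuous_norm.continuousAt.eventually (lt_mem_nhds h)

theorem kerrData_k {m a : ℝ} (hm : 0 ≤ m) {x : Space} (h : |a| < ‖x‖) (i j : Fin 3) :
    (kerrData m a).k x i j
      = ksSecondForm (fun y => m * ksProfile a y) (ksCovector a) x i j := by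
  rw [kerrData, kerrMetric_eq_ksMetric]
  refine inducedData_ksMetric_k ?_ (fun i => ?_) ?_ ?_ i j
  · exact ((contDiffAt_slice (f := ksProfile)
      (contDiffAt_ksProfile (p := (a, x)) h)).differentiableAt
      (by simp)).const_mul m
  · exact (contDiffAt_slice (f := fun a => ksCovector a i)
      (contDiffAt_ksCovector (p := (a, x)) h i)).differentiableAt (by simp)
  · exact (eventually_far h).mono fun y hy => sum_ksCovector_sq hy
  · have := (ksProfile_pos h).le
    positivity

theorem contDiffAt_ksTensor {p : ℝ × Space} (h : |p.1| < ‖p.2‖) (i j : Fin 3) :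
    ContDiffAt ℝ ∞ (fun q : ℝ × Space => ksTensor q.1 i j q.2) p :=
  contDiffAt_const.mul ((contDiffAt_ksProfile h).mul
    ((contDiffAt_ksCovector h i).mul (contDiffAt_ksCovector h j)))

theorem contDiffAt_kerrData_g (m : ℝ) {a : ℝ} {x : Space} (h : |a| < ‖x‖) (i j : Fin 3) :
    ContDiffAt ℝ ∞ (fun x => (kerrData m a).g x i j) x := by
  simp_rw [kerrData_g]
  exact contDiffAt_const.add (contDiffAt_const.mul
    (contDiffAt_slice (f := fun a => ksTensor a i j)
      (contDiffAt_ksTensor (p := (a, x)) h i j)))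

theorem contDiffAt_kerrData_k {m a : ℝ} (hm : 0 ≤ m) {x : Space} (h : |a| < ‖x‖) (i j : Fin 3) :
    ContDiffAt ℝ ∞ (fun x => (kerrData m a).k x i j) x := by
  refine ContDiffAt.congr_of_eventuallyEq ?_
    ((eventually_far h).mono fun y hy => kerrData_k hm hy i j)
  refine contDiffAt_slice (a := a) (f := fun a x =>
    ksSecondForm (fun y => m * ksProfile a y) (ksCovector a) x i j) ?_
  have hκ := contDiffAt_ksProfile (p := (a, x)) h
  have hl := contDiffAt_ksCovector (p := (a, x)) h
  have hH : ContDiffAt ℝ ∞ (fun q : ℝ × Space => m * ksProfile q.1 q.2) (a, x) :=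
    contDiffAt_const.mul hκ
  have hpos : 0 < 1 + 2 * (m * ksProfile a x) := by
    have := (ksProfile_pos h).le
    positivity
  unfold ksSecondForm
  refine ContDiffAt.mul (ContDiffAt.inv ((contDiffAt_const.add
    (contDiffAt_const.mul hH)).sqrt hpos.ne') (Real.sqrt_pos.2 hpos).ne') (((contDiffAt_pd
    (f := fun a y => m * ksProfile a y * ksCovector a j y) (hH.mul (hl j)) i).add (contDiffAt_pd
    (f := fun a y => m * ksProfile a y * ksCovector a i y) (hH.mul (hl i)) j)).add
    ((contDiffAt_const.mul hH).mul (ContDiffAt.sum fun k _ => (hl k).mul (contDiffAt_pd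
    (f := fun a y => m * ksProfile a y * (ksCovector a i y * ksCovector a j y))
    (hH.mul ((hl i).mul (hl j))) k))))

/-! ### Vanishing fluxes -/

/-- Each free index contributes one sign, and the two signs of the summed index cancel. -/
theorem ksSecondForm_signIsometry {s : Fin 3 → ℝ} (hs : ∀ i, s i * s i = 1)
    {h h' : Space → ℝ} {l l' : Fin 3 → Space → ℝ} (hh : ∀ y, h (signIsometry s hs y) = h' y)
    (hl : ∀ i y, l i (signIsometry s hs y) = s i * l' i y) (x : Space) (i j : Fin 3) :
    ksSecondForm h l (signIsometry s hs x) i j = s i * s j * ksSecondForm h' l' x i j := by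
  have h1 : ∀ i j, pd i (fun y => h y * l j y) (signIsometry s hs x)
      = s i * s j * pd i (fun y => h' y * l' j y) x := fun i j =>
    pd_signIsometry hs (fun y => by rw [hh, hl]; ring) i x
  have h2 : ∀ k, pd k (fun y => h y * (l i y * l j y)) (signIsometry s hs x)
      = s k * (s i * s j) * pd k (fun y => h' y * (l' i y * l' j y)) x := fun k =>
    pd_signIsometry hs (fun y => by rw [hh, hl, hl]; ring) k x
  have h3 : ∑ k, s k * l' k x * (s k * (s i * s j) * pd k (fun y => h' y * (l' i y * l' j y)) x)
      = s i * s j * ∑ k, l' k x * pd k (fun y => h' y * (l' i y * l' j y)) x := by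
    rw [Finset.mul_sum]
    refine Finset.sum_congr rfl fun k _ => ?_
    linear_combination (l' k x * (s i * s j) * pd k (fun y => h' y * (l' i y * l' j y)) x) * hs k
  simp only [ksSecondForm, h1, h2, hh, hl, h3]
  ring

theorem ksTensor_signIsometry {s : Fin 3 → ℝ} (hs : ∀ i, s i * s i = 1) (a : ℝ) (i j : Fin 3)
    (x : Space) :
    ksTensor (s 0 * s 1 * a) i j (signIsometry s hs x) = s i * s j * ksTensor a i j x := by
  rw [ksTensor, ksProfile_signIsometry, ksCovector_signIsometry, ksCovector_signIsometry, ksTensor]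
  ring

theorem kerrData_g_signIsometry {s : Fin 3 → ℝ} (hs : ∀ i, s i * s i = 1) (h01 : s 0 * s 1 = 1)
    (m a : ℝ) (x : Space) (i j : Fin 3) :
    (kerrData m a).g (signIsometry s hs x) i j = s i * s j * (kerrData m a).g x i j := by
  have h := ksTensor_signIsometry hs a i j x
  rw [h01, one_mul] at h
  rw [kerrData_g, kerrData_g, h]
  split_ifs with hij
  · rw [hij, hs]; ring
  · ring

theorem kerrData_k_signIsometry {s : Fin 3 → ℝ} (hs : ∀ i, s i * s i = 1) (h01 : s 0 * s 1 = 1)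
    {m a : ℝ} (hm : 0 ≤ m) {x : Space} (hx : |a| < ‖x‖) (i j : Fin 3) :
    (kerrData m a).k (signIsometry s hs x) i j = s i * s j * (kerrData m a).k x i j := by
  rw [kerrData_k hm hx, kerrData_k hm (by simpa using hx)]
  refine ksSecondForm_signIsometry hs (fun y => ?_) (fun i y => ?_) x i j
  · rw [← ksProfile_signIsometry hs a y, h01, one_mul]
  · rw [← ksCovector_signIsometry hs a i y, h01, one_mul]

theorem sphereIntegral_eq_zero_of_odd {s : Fin 3 → ℝ} (hs : ∀ i, s i * s i = 1) {r : ℝ}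
    (hr : 0 < r) {f : Space → Space → ℝ}
    (hf : ∀ x w, ‖x‖ = r → f (signIsometry s hs x) (signIsometry s hs w) = -f x w) :
    sphereIntegral r f = 0 := by
  rw [sphereIntegral, integral_sphere_eq_zero_of_odd (signIsometry s hs)
    (f := fun w => f (r • w) w), mul_zero]
  intro w
  rw [← map_smul]
  exact hf _ _ (by simp [norm_smul, hr.le])

theorem neg_one_mul_self_fin (i : Fin 3) : (fun _ : Fin 3 => (-1 : ℝ)) i * (fun _ => -1) i = 1 := by
  norm_num

theorem momentumTensor_signIsometry {s : Fin 3 → ℝ} (hs : ∀ i, s i * s i = 1)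
    (h01 : s 0 * s 1 = 1) {m a : ℝ} (hm : 0 ≤ m) {x : Space} (hx : |a| < ‖x‖) (i j : Fin 3) :
    momentumTensor (kerrData m a) (signIsometry s hs x) i j
      = s i * s j * momentumTensor (kerrData m a) x i j := by
  have h1 : ((kerrData m a).k (signIsometry s hs x)).trace = ((kerrData m a).k x).trace := by
    simp only [Matrix.trace, Matrix.diag_apply, kerrData_k_signIsometry hs h01 hm hx, hs, one_mul]
  rw [momentumTensor, momentumTensor, kerrData_k_signIsometry hs h01 hm hx, h1, δ]
  split_ifs with hij
  · rw [hij, hs]; ring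
  · ring

theorem massCovector_signIsometry {s : Fin 3 → ℝ} (hs : ∀ i, s i * s i = 1)
    (h01 : s 0 * s 1 = 1) (m a : ℝ) (x : Space) (j : Fin 3) :
    massCovector (kerrData m a) (signIsometry s hs x) j
      = s j * massCovector (kerrData m a) x j := by
  rw [massCovector, massCovector, Finset.mul_sum]
  refine Finset.sum_congr rfl fun i _ => ?_
  rw [pd_signIsometry hs (kerrData_g_signIsometry hs h01 m a · i j),
    pd_signIsometry hs (kerrData_g_signIsometry hs h01 m a · i i), ← mul_assoc (s i), hs,
    mul_one, one_mul, mul_sub]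

/-- Under the antipodal map k is even, since both of its indices change sign, while ν is odd. -/
theorem momentum_kerrData_eq_zero {m a r : ℝ} (hm : 0 ≤ m) (hr : |a| < r) (i : Fin 3) :
    momentum (kerrData m a) i r = 0 := by
  refine sphereIntegral_eq_zero_of_odd neg_one_mul_self_fin ((abs_nonneg a).trans_lt hr)
    fun x w hx => ?_
  rw [← Finset.sum_neg_distrib]
  refine Finset.sum_congr rfl fun j _ => ?_
  rw [momentumTensor_signIsometry _ (by norm_num) hm (by rwa [hx]), signIsometry_apply]
  ring

/-- Under the antipodal map g is even, so its first derivatives are odd; paired with x_l and ν they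
give an odd integrand, and so does (g - e) paired with ν. -/
theorem center_kerrData_eq_zero {m a r : ℝ} (hr : 0 < r) (l : Fin 3) :
    center (kerrData m a) l r = 0 := by
  rw [center, sphereIntegral_eq_zero_of_odd neg_one_mul_self_fin hr, mul_zero]
  intro x w _
  rw [← Finset.sum_neg_distrib]
  refine Finset.sum_congr rfl fun j _ => ?_
  simp only [massCovector_signIsometry neg_one_mul_self_fin (by norm_num),
    kerrData_g_signIsometry neg_one_mul_self_fin (by norm_num), signIsometry_apply]
  simp only [mul_neg, neg_mul, one_mul, neg_neg]

/-- The signs of the rotation by `π` about the `z`-axis. -/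
def halfTurn : Fin 3 → ℝ := ![-1, -1, 1]

theorem halfTurn_mul_self (i : Fin 3) : halfTurn i * halfTurn i = 1 := by
  fin_cases i <;> simp [halfTurn]

theorem rotationField_eq (l : Fin 3) (x : Space) : rotationField l x =
    ![![0, -x 2, x 1], ![x 2, 0, -x 0], ![-x 1, x 0, 0]] l := by
  ext i
  fin_cases l <;> fin_cases i <;> simp [rotationField, crossProduct]

theorem rotationField_halfTurn (l i : Fin 3) (x : Space) :
    rotationField l (signIsometry halfTurn halfTurn_mul_self x) i
      = halfTurn l * halfTurn i * rotationField l x i := by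
  rw [rotationField_eq, rotationField_eq]
  fin_cases l <;> fin_cases i <;> simp [halfTurn]

/-- The half turn about z preserves Kerr but reverses the rotations about the x- and y-axes. The
antipodal map would not help, since it leaves the integrand of J even. -/
theorem angularMomentum_kerrData_eq_zero {m a r : ℝ} (hm : 0 ≤ m) (hr : |a| < r) {l : Fin 3}
    (hl : l ≠ 2) : angularMomentum (kerrData m a) l r = 0 := by
  have hl' : halfTurn l = -1 := by fin_cases l <;> simp_all [halfTurn]
  refine sphereIntegral_eq_zero_of_odd halfTurn_mul_self ((abs_nonneg a).trans_lt hr)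
    fun x w hx => ?_
  simp only [← Finset.sum_neg_distrib]
  refine Finset.sum_congr rfl fun i _ => Finset.sum_congr rfl fun j _ => ?_
  rw [momentumTensor_signIsometry _ (by simp [halfTurn]) hm (by rwa [hx]), signIsometry_apply,
    rotationField_halfTurn, hl']
  linear_combination (-momentumTensor (kerrData m a) x i j * rotationField l x i * w j) *
    (halfTurn j * halfTurn j * halfTurn_mul_self i + halfTurn_mul_self j)

/-! ### The energy -/

/-- The flux density `(∂_i γ_{ij} - ∂_j γ_{ii}) x^j` of the mass-normalized perturbation. -/
def massFlux (a : ℝ) (x : Space) : ℝ :=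
  ∑ j, (∑ i, (pd i (ksTensor a i j) x - pd j (ksTensor a i i) x)) * x j

theorem massCovector_kerrData (m a : ℝ) (x : Space) (j : Fin 3) :
    massCovector (kerrData m a) x j
      = m * ∑ i, (pd i (ksTensor a i j) x - pd j (ksTensor a i i) x) := by
  rw [massCovector, Finset.mul_sum]
  refine Finset.sum_congr rfl fun i _ => ?_
  simp_rw [kerrData_g]
  rw [pd_const_add, pd_const_add, pd_const_mul, pd_const_mul, mul_sub]

theorem ksTensor_smul {c : ℝ} (hc : 0 < c) (a : ℝ) (i j : Fin 3) (x : Space) :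
    ksTensor (c * a) i j (c • x) = c⁻¹ * ksTensor a i j x := by
  rw [ksTensor, ksProfile_smul hc, ksCovector_smul hc, ksCovector_smul hc, ksTensor]
  ring

/-- Derivatives of the normalized perturbation have degree -2, which cancels the area factor r². -/
theorem energy_kerrData (m a : ℝ) {r : ℝ} (hr : 0 < r) : energy (kerrData m a) r
    = m * (1 / 2 * ∫ w : sphere (0 : Space) 1, massFlux (r⁻¹ • a) w ∂sphereMeasure) := by
  have ha : r * (r⁻¹ • a) = a := by rw [smul_eq_mul, mul_inv_cancel_left₀ hr.ne']
  have h : ∀ w : sphere (0 : Space) 1,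
      ∑ j, massCovector (kerrData m a) (r • (w : Space)) j * (w : Space) j
      = m * (r ^ 2)⁻¹ * massFlux (r⁻¹ • a) w := by
    intro w
    rw [massFlux, Finset.mul_sum]
    refine Finset.sum_congr rfl fun j _ => ?_
    have hh : ∀ i j k : Fin 3, pd k (ksTensor a i j) (r • (w : Space))
        = (r ^ 2)⁻¹ * pd k (ksTensor (r⁻¹ • a) i j) w := fun i j k => by
      rw [pd_smul_of_homogeneous hr.ne' (f := ksTensor a i j) (g := ksTensor (r⁻¹ • a) i j)
        (t := r⁻¹) (fun y => by rw [← ksTensor_smul hr, ha])]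
      ring
    rw [massCovector_kerrData]
    simp only [hh, ← mul_sub, ← Finset.mul_sum]
    ring
  rw [energy, sphereIntegral]
  simp_rw [h]
  rw [integral_const_mul]
  field_simp

theorem contDiffAt_massFlux {p : ℝ × Space} (h : |p.1| < ‖p.2‖) :
    ContDiffAt ℝ ∞ (fun q : ℝ × Space => massFlux q.1 q.2) p := by
  unfold massFlux
  refine ContDiffAt.sum fun j _ => ContDiffAt.mul (ContDiffAt.sum fun i _ => ?_) (by fun_prop)
  exact (contDiffAt_pd (f := fun a => ksTensor a i j) (contDiffAt_ksTensor h i j) i).sub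
    (contDiffAt_pd (f := fun a => ksTensor a i i) (contDiffAt_ksTensor h i i) j)

theorem massFlux_signIsometry {s : Fin 3 → ℝ} (hs : ∀ i, s i * s i = 1) (a : ℝ) (x : Space) :
    massFlux (s 0 * s 1 * a) (signIsometry s hs x) = massFlux a x := by
  unfold massFlux
  refine Finset.sum_congr rfl fun j _ => ?_
  have h : ∀ i : Fin 3, pd i (ksTensor (s 0 * s 1 * a) i j) (signIsometry s hs x)
      - pd j (ksTensor (s 0 * s 1 * a) i i) (signIsometry s hs x)
      = s j * (pd i (ksTensor a i j) x - pd j (ksTensor a i i) x) := by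
    intro i
    rw [pd_signIsometry hs (ksTensor_signIsometry hs a i j),
      pd_signIsometry hs (ksTensor_signIsometry hs a i i), ← mul_assoc (s i), hs, mul_one,
      one_mul, mul_sub]
  simp only [h, ← Finset.mul_sum, signIsometry_apply]
  linear_combination ((∑ i, (pd i (ksTensor a i j) x - pd j (ksTensor a i i) x)) * x j) * hs j

theorem ksProfile_zero_mul_norm {x : Space} (hx : x ≠ 0) : ksProfile 0 x * ‖x‖ = 1 := by
  have := norm_pos_iff.2 hx
  rw [ksProfile, ksRadius_zero]
  field_simp
  ring

theorem ksCovector_zero {x : Space} (hx : x ≠ 0) (i : Fin 3) :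
    ksCovector 0 i x = ksProfile 0 x * x i := by
  have h0 := norm_pos_iff.2 hx
  have h1 : ksProfile 0 x = ‖x‖⁻¹ := eq_inv_of_mul_eq_one_left (ksProfile_zero_mul_norm hx)
  rw [h1]
  fin_cases i <;> simp [ksCovector, ksRadius_zero] <;> field_simp

/-- For a = 0 put κ = 1/|x|. Then γ_{ij} x^j = 2κ x_i and tr γ = 2κ, so (∂_i γ_{ij}) x^j = 2∂_i(κ
x_i) - tr γ. The radial derivatives of κ cancel against those of the trace, leaving 6 - 2 = 4. -/
theorem massFlux_zero {x : Space} (hx : ‖x‖ = 1) : massFlux 0 x = 4 := by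
  have hfar : |(0 : ℝ)| < ‖x‖ := by simp [hx]
  have hne : ∀ᶠ y in 𝓝 x, y ≠ (0 : Space) := by
    filter_upwards [eventually_far hfar] with y hy
    simpa using hy
  have hκ : DifferentiableAt ℝ (ksProfile 0) x :=
    (contDiffAt_slice (f := ksProfile)
      (contDiffAt_ksProfile (p := (0, x)) hfar)).differentiableAt (by simp)
  have hT : ∀ i j, DifferentiableAt ℝ (ksTensor 0 i j) x := fun i j =>
    (contDiffAt_slice (f := fun a => ksTensor a i j)
      (contDiffAt_ksTensor (p := (0, x)) hfar i j)).differentiableAt (by simp)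
  have hc := fun j => differentiableAt_coord j x
  have hκx : ksProfile 0 x = 1 := by
    have := ksProfile_zero_mul_norm (x := x) (by rintro rfl; simp at hx)
    rwa [hx, mul_one] at this
  have hEuler : ∑ k, x k * pd k (ksProfile 0) x = -1 := by
    rw [sum_coord_mul_pd, fderiv_self_of_homogeneous_neg_one hκ, hκx]
    intro c hc
    have := ksProfile_smul hc 0 x
    rwa [mul_zero] at this
  have hcov : ∀ᶠ y in 𝓝 x, ∀ i, ∑ j, ksTensor 0 i j y * y j = 2 * (ksProfile 0 y * y i) := by
    filter_upwards [hne, eventually_far hfar] with y hy hy' i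
    have h1 := sum_ksCovector_mul_coord hy'
    rw [ksRadius_zero] at h1
    have h2 := ksProfile_zero_mul_norm hy
    simp only [ksTensor, Fin.sum_univ_three] at h1 ⊢
    rw [← ksCovector_zero hy]
    linear_combination (2 * ksProfile 0 y * ksCovector 0 i y) * h1 + (2 * ksCovector 0 i y) * h2
  have htr : ∀ᶠ y in 𝓝 x, ∑ i, ksTensor 0 i i y = 2 * ksProfile 0 y := by
    filter_upwards [eventually_far hfar] with y hy
    have h1 := sum_ksCovector_sq hy
    simp only [ksTensor, Fin.sum_univ_three] at h1 ⊢
    linear_combination (2 * ksProfile 0 y) * h1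
  have e1 : ∀ j, ∑ i, pd j (ksTensor 0 i i) x = 2 * pd j (ksProfile 0) x := by
    intro j
    rw [← pd_sum fun i => hT i i, pd_congr htr, pd_const_mul]
  have e2 : ∀ i, ∑ j, pd i (ksTensor 0 i j) x * x j + ksTensor 0 i i x
      = 2 * (pd i (ksProfile 0) x * x i + ksProfile 0 x) := by
    intro i
    have h1 : pd i (fun y => ∑ j, ksTensor 0 i j y * y j) x
        = pd i (fun y => 2 * (ksProfile 0 y * y i)) x := pd_congr (hcov.mono fun y hy => hy i) i
    rw [pd_const_mul, pd_mul hκ (hc i), pd_coord, if_pos rfl, mul_one,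
      pd_sum fun j => (hT i j).fun_mul (hc j)] at h1
    simp_rw [pd_mul (hT i _) (hc _), pd_coord, Finset.sum_add_distrib] at h1
    simpa using h1
  have htrx := htr.self_of_nhds
  rw [hκx] at htrx e2
  rw [massFlux]
  simp only [Finset.sum_sub_distrib, e1]
  simp only [Fin.sum_univ_three] at *
  linear_combination e2 0 + e2 1 + e2 2 - htrx

/-! ### The angular momentum -/

/-- The flux density of the `z`-component of the angular momentum of Kerr, divided by `m a`. -/
def angularDensity (q : ℝ × ℝ) (x : Space) : ℝ :=
  (√(1 + 2 * (q.1 * ksProfile q.2 x)))⁻¹ *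
    (2 * (ksProfile q.2 x * ksWeight q.2 x)
      - ∑ k, x k * pd k (fun y => ksProfile q.2 y * ksWeight q.2 y) x
      + 2 * (q.1 * ksProfile q.2 x) * (ksProfile q.2 x * ksWeight q.2 x
        - ∑ k, ksCovector q.2 k x *
            pd k (fun y => ksProfile q.2 y * ksWeight q.2 y * ksRadius q.2 y) x))

theorem ksProfile_mul_ksRadius_axisymmetric {a : ℝ} {x y : Space}
    (h : y 0 ^ 2 + y 1 ^ 2 = x 0 ^ 2 + x 1 ^ 2) (hz : y 2 = x 2) :
    ksProfile a y * ksRadius a y = ksProfile a x * ksRadius a x := by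
  have : ksRadius a y = ksRadius a x := by simp only [ksRadius, kerrRadius, h, hz]
  simp only [ksProfile, this, hz]

theorem sum_kerrData_k_rotation {m a : ℝ} (hm : 0 ≤ m) {x : Space} (h : |a| < ‖x‖) :
    ∑ i, ∑ j, (kerrData m a).k x i j * ![-x 1, x 0, 0] i * x j
      = m * a * angularDensity (m, a) x := by
  have hκ : DifferentiableAt ℝ (ksProfile a) x :=
    (contDiffAt_slice (f := ksProfile)
      (contDiffAt_ksProfile (p := (a, x)) h)).differentiableAt (by simp)
  have hρ : DifferentiableAt ℝ (ksRadius a) x :=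
    (contDiffAt_slice (f := ksRadius)
      (contDiffAt_ksRadius (p := (a, x)) h)).differentiableAt (by simp)
  have hl : ∀ i, DifferentiableAt ℝ (ksCovector a i) x := fun i =>
    (contDiffAt_slice (f := fun a => ksCovector a i)
      (contDiffAt_ksCovector (p := (a, x)) h i)).differentiableAt (by simp)
  simp_rw [kerrData_k hm h]
  rw [sum_ksSecondForm_rotation (R := ksRadius a) (S := fun y => -a * ksWeight a y)
    (hκ.const_mul m) hl (sum_ksCovector_sq h)
    ((eventually_far h).mono fun y hy => sum_ksCovector_mul_coord hy)
    (Eventually.of_forall fun y => sum_ksCovector_mul_rotation a y)]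
  · have h1 : ∀ k, pd k (fun y => m * ksProfile a y * (-a * ksWeight a y)) x
        = -(m * a) * pd k (fun y => ksProfile a y * ksWeight a y) x := fun k => by
      rw [← pd_const_mul]; congr 1; funext y; ring
    have h2 : ∀ k, pd k (fun y => m * ksProfile a y * (-a * ksWeight a y) * ksRadius a y) x
        = -(m * a) * pd k (fun y => ksProfile a y * ksWeight a y * ksRadius a y) x := fun k => by
      rw [← pd_const_mul]; congr 1; funext y; ring
    simp only [h1, h2, angularDensity, Fin.sum_univ_three]
    ring
  -- The scalar hR is m times profile times radius, which depends only on x² + y² and z.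
  · refine fderiv_rotation_of_axisymmetric ((hκ.const_mul m).fun_mul hρ) fun y hy hz => ?_
    rw [mul_assoc, mul_assoc, ksProfile_mul_ksRadius_axisymmetric hy hz]

theorem angularDensity_smul {c : ℝ} (hc : 0 < c) (q : ℝ × ℝ) (x : Space) :
    angularDensity (c • q) (c • x) = c⁻¹ * angularDensity q x := by
  have h1 : ∀ k, pd k (fun y => ksProfile (c * q.2) y * ksWeight (c * q.2) y) (c • x)
      = c⁻¹ * c⁻¹ * pd k (fun y => ksProfile q.2 y * ksWeight q.2 y) x := fun k =>
    pd_smul_of_homogeneous hc.ne' (fun y => by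
      rw [ksProfile_smul hc, ksWeight_smul hc]; ring) k x
  have h2 : ∀ k, pd k (fun y => ksProfile (c * q.2) y * ksWeight (c * q.2) y
      * ksRadius (c * q.2) y) (c • x)
      = c⁻¹ * 1 * pd k (fun y => ksProfile q.2 y * ksWeight q.2 y * ksRadius q.2 y) x := fun k =>
    pd_smul_of_homogeneous hc.ne' (fun y => by
      rw [ksProfile_smul hc, ksWeight_smul hc, ksRadius_smul hc]; field_simp) k x
  have h3 : c * q.1 * (c⁻¹ * ksProfile q.2 x) = q.1 * ksProfile q.2 x := by field_simp
  simp only [angularDensity, Prod.smul_fst, Prod.smul_snd, smul_eq_mul, h1, h2, h3,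
    ksProfile_smul hc, ksWeight_smul hc, ksCovector_smul hc, PiLp.smul_apply, Fin.sum_univ_three]
  field_simp

theorem angularMomentum_kerrData {m a r : ℝ} (hm : 0 ≤ m) (hr : |a| < r) :
    angularMomentum (kerrData m a) 2 r
      = m * a * ∫ w : sphere (0 : Space) 1, angularDensity (r⁻¹ • (m, a)) w ∂sphereMeasure := by
  have hr0 : 0 < r := (abs_nonneg a).trans_lt hr
  have h : ∀ w : sphere (0 : Space) 1, ∑ i, ∑ j, momentumTensor (kerrData m a) (r • (w : Space)) i j
      * rotationField 2 (r • (w : Space)) i * (w : Space) j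
      = m * a * (r ^ 2)⁻¹ * angularDensity (r⁻¹ • (m, a)) w := by
    intro w
    have hx : |a| < ‖r • (w : Space)‖ := by simpa [norm_smul, hr0.le] using hr.trans_le (le_abs_self r)
    have h1 := sum_kerrData_k_rotation hm hx
    have h2 := angularDensity_smul hr0 (r⁻¹ • (m, a)) w
    rw [smul_inv_smul₀ hr0.ne'] at h2
    rw [h2] at h1
    -- The trace term drops out because the rotation field is tangent to the sphere; the factor r⁻¹
    -- comes from ν = x/r.
    have h3 : ∑ i, ∑ j, momentumTensor (kerrData m a) (r • (w : Space)) i j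
      * rotationField 2 (r • (w : Space)) i * (w : Space) j
      = r⁻¹ * ∑ i, ∑ j, (kerrData m a).k (r • (w : Space)) i j
        * ![-(r • (w : Space)) 1, (r • (w : Space)) 0, 0] i * (r • (w : Space)) j := by
      rw [rotationField_eq]
      simp only [momentumTensor, δ, Fin.sum_univ_three, PiLp.smul_apply, smul_eq_mul]
      simp
      field_simp
      ring
    rw [h3, h1]
    field_simp
  rw [angularMomentum, sphereIntegral]
  simp_rw [h]
  rw [integral_const_mul]
  field_simp

theorem contDiffAt_angularDensity {p : (ℝ × ℝ) × Space} (h : |p.1.2| < ‖p.2‖)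
    (hpos : 0 < 1 + 2 * (p.1.1 * ksProfile p.1.2 p.2)) :
    ContDiffAt ℝ ∞ (fun q : (ℝ × ℝ) × Space => angularDensity q.1 q.2) p := by
  have hp : ContDiffAt ℝ ∞ (fun q : (ℝ × ℝ) × Space => (q.1.2, q.2)) p := by fun_prop
  have lift : ∀ {f : ℝ → Space → ℝ},
      ContDiffAt ℝ ∞ (fun q : ℝ × Space => f q.1 q.2) (p.1.2, p.2) →
      ContDiffAt ℝ ∞ (fun q : (ℝ × ℝ) × Space => f q.1.2 q.2) p := fun hf =>
    ContDiffAt.comp (f := fun q : (ℝ × ℝ) × Space => (q.1.2, q.2)) p hf hp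
  have hκ := contDiffAt_ksProfile (p := (p.1.2, p.2)) h
  have hσ := contDiffAt_ksWeight (p := (p.1.2, p.2)) h
  have hρ := contDiffAt_ksRadius (p := (p.1.2, p.2)) h
  have h1 := fun k => lift (f := fun a => pd k fun y => ksProfile a y * ksWeight a y)
    (contDiffAt_pd (f := fun a y => ksProfile a y * ksWeight a y)
    (hκ.mul hσ) k)
  have h2 := fun k => lift (f := fun a => pd k fun y => ksProfile a y * ksWeight a y * ksRadius a y)
    (contDiffAt_pd
    (f := fun a y => ksProfile a y * ksWeight a y * ksRadius a y) ((hκ.mul hσ).mul hρ) k)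
  have h3 := fun k => lift (f := fun a => ksCovector a k)
    (contDiffAt_ksCovector (p := (p.1.2, p.2)) h k)
  have h4 : ContDiffAt ℝ ∞ (fun q : (ℝ × ℝ) × Space => q.1.1 * ksProfile q.1.2 q.2) p :=
    ContDiffAt.mul (by fun_prop) (lift hκ)
  have h5 := (lift hκ).mul (lift hσ)
  unfold angularDensity
  refine ContDiffAt.mul (ContDiffAt.inv ((contDiffAt_const.add
    (contDiffAt_const.mul h4)).sqrt hpos.ne') (Real.sqrt_pos.2 hpos).ne') ?_
  refine ((contDiffAt_const.mul h5).sub (ContDiffAt.sum fun k _ =>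
    ContDiffAt.mul (by fun_prop) (h1 k))).add ((contDiffAt_const.mul h4).mul
    (h5.sub (ContDiffAt.sum fun k _ => (h3 k).mul (h2 k))))

/-- At zero mass only the part linear in h remains. The product of profile and weight has degree -1,
so Euler's identity turns 2κσ - x·∂(κσ) into 3κσ. -/
theorem angularDensity_zero {x : Space} (hx : ‖x‖ = 1) :
    angularDensity 0 x = 3 * (x 0 ^ 2 + x 1 ^ 2) := by
  have hfar : |(0 : ℝ)| < ‖x‖ := by simp [hx]
  have hκ : DifferentiableAt ℝ (ksProfile 0) x :=
    (contDiffAt_slice (f := ksProfile)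
      (contDiffAt_ksProfile (p := (0, x)) hfar)).differentiableAt (by simp)
  have hσ : DifferentiableAt ℝ (ksWeight 0) x :=
    (contDiffAt_slice (f := ksWeight)
      (contDiffAt_ksWeight (p := (0, x)) hfar)).differentiableAt (by simp)
  have h1 : ∑ k, x k * pd k (fun y => ksProfile 0 y * ksWeight 0 y) x
      = -(ksProfile 0 x * ksWeight 0 x) := by
    rw [sum_coord_mul_pd, fderiv_self_of_homogeneous_neg_one (hκ.fun_mul hσ)]
    intro c hc
    have e1 := ksProfile_smul hc 0 x
    have e2 := ksWeight_smul hc 0 x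
    rw [mul_zero] at e1 e2
    rw [e1, e2, mul_assoc]
  simp only [angularDensity, Prod.fst_zero, Prod.snd_zero, h1]
  simp [ksProfile, ksWeight, ksRadius_zero, hx]
  ring

/-! ### The error bounds -/

theorem exists_norm_scaledDeriv_le {E : Type} [NormedAddCommGroup E] [NormedSpace ℝ E]
    [ProperSpace E] {F : E → ℝ} {c c' : ℝ} (hc : c' < c) (hF : ContDiffOn ℝ ∞ F (ball 0 c))
    (h0 : F 0 = 0) (l : ℕ) :
    ∃ C, 0 ≤ C ∧ ∀ x ∈ closedBall (0 : E) c', ‖scaledDeriv F l x‖ ≤ C * ‖x‖ ^ 1 := by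
  simpa [scaledDeriv_zero h0] using
    exists_norm_sub_le hc (contDiffOn_scaledDeriv isOpen_ball hF l)

theorem exists_norm_scaledDeriv_le_sq {E : Type} [NormedAddCommGroup E] [NormedSpace ℝ E]
    [ProperSpace E] {F : E → ℝ} {c c' : ℝ} (hc0 : 0 < c) (hc : c' < c)
    (hF : ContDiffOn ℝ ∞ F (ball 0 c)) (h0 : F 0 = 0) (h1 : fderiv ℝ F 0 = 0) (l : ℕ) :
    ∃ C, 0 ≤ C ∧ ∀ x ∈ closedBall (0 : E) c', ‖scaledDeriv F l x‖ ≤ C * ‖x‖ ^ 2 := by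
  simpa [scaledDeriv_zero h0] using
    exists_norm_sub_le_sq hc (contDiffOn_scaledDeriv isOpen_ball hF l)
      (fderiv_scaledDeriv_zero isOpen_ball (mem_ball_self hc0) hF h1 l)

/-- Expanding about (0, 0) needs a full neighbourhood, including negative mass parameters. From |v|
< 1/4 one gets ρ ≥ 1/2, so the profile is at most 2, and |u| < 1/4 then keeps the radicand positive.
-/
theorem one_add_profile_pos {u v : ℝ} (hu : |u| < 1 / 4) (hv : |v| < 1 / 4) {x : Space}
    (hx : ‖x‖ = 1) : 0 < 1 + 2 * (u * ksProfile v x) := by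
  have hfar : |v| < ‖x‖ := by rw [hx]; linarith
  have hρ := ksRadius_pos hfar
  have h1 := norm_sq_sub_le_ksRadius_sq hfar
  have h2 : v ^ 2 ≤ 1 / 16 := by
    rw [← sq_abs]; nlinarith [abs_nonneg v]
  have h3 : 1 / 2 ≤ ksRadius v x := by
    rw [hx] at h1
    nlinarith
  have h4 : ksProfile v x ≤ 2 := by
    rw [ksProfile, div_le_iff₀ (ksProfile_denom_pos hfar)]
    have h5 : 0 ≤ v ^ 2 * x 2 ^ 2 := by positivity
    have h6 : ksRadius v x ^ 3 * (1 / 2) ≤ ksRadius v x ^ 3 * ksRadius v x := by gcongr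
    nlinarith
  have h7 := (ksProfile_pos hfar)
  have h8 := (abs_lt.1 hu).1
  nlinarith

theorem isKerrO_energy :
    IsKerrO 8 3 2 (fun m a r => energy (kerrData m a) r - 8 * Real.pi * m) := by
  set F : ℝ → ℝ := fun v => 1 / 2 * (∫ w : sphere (0 : Space) 1, massFlux v w ∂sphereMeasure)
    - 8 * Real.pi with hFdef
  have hF : ContDiffOn ℝ ∞ F (ball 0 (1 / 4)) := by
    refine ContDiffOn.sub (contDiffOn_const.mul ?_) contDiffOn_const
    refine contDiffOn_integral_of_contDiffAt (h := fun p : ℝ × Space => massFlux p.1 p.2)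
      continuous_subtype_val isOpen_ball fun v hv w => contDiffAt_massFlux ?_
    have : |v| < 1 / 4 := by simpa using hv
    simp
    linarith
  have h0 : F 0 = 0 := by
    have : ∀ w : sphere (0 : Space) 1, massFlux 0 w = 4 := fun w => massFlux_zero (by simp)
    simp only [hFdef, this, integral_const, sphereMeasure_real_univ, smul_eq_mul]
    ring
  -- Reflection in y, for which s₀ s₁ = -1; it makes `F` even in a/r, hence the quadratic error.
  have hs : ∀ i, (![1, -1, 1] : Fin 3 → ℝ) i * (![1, -1, 1] : Fin 3 → ℝ) i = 1 := by
    intro i; fin_cases i <;> simp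
  have heven : ∀ v ∈ ball (0 : ℝ) (1 / 4), F (-v) = F v := by
    intro v _
    simp only [hFdef]
    rw [← integral_sphere_comp (signIsometry _ hs)]
    have h : ∀ w : sphere (0 : Space) 1, massFlux (-v) (signIsometry _ hs w) = massFlux v w :=
      fun w => by simpa using massFlux_signIsometry hs v (w : Space)
    simp_rw [h]
  -- The weight is m and the vanishing order 2. With R₀ = 8, |a|/r stays below 1/8, inside the
  -- radius 1/4 on which `F` is smooth.
  refine isKerrO_of_scaling (n := 1) (k := 2) (c := 1 / 4) (F := F) (by norm_num) (by norm_num) hF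
    (exists_norm_scaledDeriv_le_sq (by norm_num) (by norm_num) hF h0
      (fderiv_zero_of_even (by norm_num) hF heven)) (w := fun m _ => m) (q := fun _ a => a)
    (fun m a hm => ?_) (fun m a hm => ?_) fun m a r hm hr => ?_
  · rw [abs_of_nonneg hm, pow_one]
    linarith [abs_nonneg a]
  · rw [Real.norm_eq_abs]; linarith
  · have hr0 : 0 < r := lt_of_le_of_lt (by positivity) hr
    simp only [energy_kerrData m a hr0, hFdef]
    ring

theorem isKerrO_angularMomentum :
    IsKerrO 8 3 1 (fun m a r => angularMomentum (kerrData m a) 2 r - 8 * Real.pi * a * m) := by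
  set F : ℝ × ℝ → ℝ := fun q => (∫ w : sphere (0 : Space) 1, angularDensity q w ∂sphereMeasure)
    - 8 * Real.pi with hFdef
  have hF : ContDiffOn ℝ ∞ F (ball 0 (1 / 4)) := by
    refine ContDiffOn.sub ?_ contDiffOn_const
    refine contDiffOn_integral_of_contDiffAt
      (h := fun p : (ℝ × ℝ) × Space => angularDensity p.1 p.2)
      continuous_subtype_val isOpen_ball fun q hq w => ?_
    have hq' : |q.1| < 1 / 4 ∧ |q.2| < 1 / 4 := by simpa [Prod.norm_def] using hq
    refine contDiffAt_angularDensity ?_ (one_add_profile_pos hq'.1 hq'.2 (by simp))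
    simp
    linarith [hq'.2]
  have h0 : F 0 = 0 := by
    have : ∀ w : sphere (0 : Space) 1,
        angularDensity 0 w = 3 * ((w : Space) 0 ^ 2 + (w : Space) 1 ^ 2) := fun w =>
      angularDensity_zero (by simp)
    have hi : ∀ i : Fin 3, Integrable (fun w : sphere (0 : Space) 1 => (w : Space) i ^ 2)
      sphereMeasure := fun i => integrable_sphere (f := fun x => x i ^ 2) (by fun_prop)
    simp only [hFdef, this]
    rw [integral_const_mul, integral_add (hi 0) (hi 1), integral_sphere_coord_sq,
      integral_sphere_coord_sq]
    ring
  -- The weight m a has degree 2; the mass dependence through the lapse has no parity, so only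
  -- first-order vanishing is used.
  refine isKerrO_of_scaling (n := 2) (k := 1) (c := 1 / 4) (F := F) (by norm_num) (by norm_num) hF
    (exists_norm_scaledDeriv_le (by norm_num) hF h0) (w := fun m a => m * a)
    (q := fun m a => (m, a)) (fun m a hm => ?_) (fun m a hm => ?_) fun m a r hm hr => ?_
  · rw [abs_mul, abs_of_nonneg hm]
    nlinarith [abs_nonneg a, mul_nonneg hm (abs_nonneg a)]
  · rw [Prod.norm_def, Real.norm_eq_abs, Real.norm_eq_abs, abs_of_nonneg hm]
    exact max_le (by linarith [abs_nonneg a]) (by linarith)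
  · have hra : |a| < r := by linarith [abs_nonneg a]
    simp only [angularMomentum_kerrData hm hra, hFdef]
    ring

end KerrADM

end

/-! ### Assembly of smoothness and the four expansions. -/

theorem proposition3p1 :
    -- the Kerr data are smooth outside the closed ball of radius `|a|`
    (∀ m a : ℝ, 0 ≤ m → ∀ i j : Fin 3,
      ContDiffOn ℝ ∞ (fun x => (KerrADM.kerrData m a).g x i j) {x | |a| < ‖x‖} ∧
      ContDiffOn ℝ ∞ (fun x => (KerrADM.kerrData m a).k x i j) {x | |a| < ‖x‖}) ∧
    -- expansions of the fluxes, uniformly for `r > R₀ (m + |a|)`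
    ∃ R₀ : ℝ, 1 ≤ R₀ ∧
      KerrADM.IsKerrO R₀ 3 2
        (fun m a r => KerrADM.energy (KerrADM.kerrData m a) r - 8 * Real.pi * m) ∧
      (∀ i : Fin 3, KerrADM.IsKerrO R₀ 3 2
        (fun m a r => KerrADM.momentum (KerrADM.kerrData m a) i r)) ∧
      (∀ l : Fin 3, KerrADM.IsKerrO R₀ 3 1
        (fun m a r => KerrADM.center (KerrADM.kerrData m a) l r)) ∧
      (∀ l : Fin 3, KerrADM.IsKerrO R₀ 3 1
        (fun m a r => KerrADM.angularMomentum (KerrADM.kerrData m a) l r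
          - 8 * Real.pi * a * m * (Pi.single 2 1 : Fin 3 → ℝ) l)) := by
  have hfar : ∀ {m a r : ℝ}, 0 ≤ m → 8 * (m + |a|) < r → |a| < r := fun {m a r} hm hr => by
    linarith [abs_nonneg a]
  refine ⟨fun m a hm i j => ⟨fun x hx => ?_, fun x hx => ?_⟩, 8, by norm_num,
    KerrADM.isKerrO_energy, fun i => ?_, fun l => ?_, fun l => ?_⟩
  · exact (KerrADM.contDiffAt_kerrData_g m hx i j).contDiffWithinAt
  · exact (KerrADM.contDiffAt_kerrData_k hm hx i j).contDiffWithinAt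
  · exact KerrADM.isKerrO_of_eq_zero fun m a r hm hr =>
      KerrADM.momentum_kerrData_eq_zero hm (hfar hm hr) i
  · exact KerrADM.isKerrO_of_eq_zero fun m a r hm hr =>
      KerrADM.center_kerrData_eq_zero ((abs_nonneg a).trans_lt (hfar hm hr)) l
  · by_cases hl : l = 2
    · subst hl
      simpa using KerrADM.isKerrO_angularMomentum
    · refine KerrADM.isKerrO_of_eq_zero fun m a r hm hr => ?_
      rw [KerrADM.angularMomentum_kerrData_eq_zero hm (hfar hm hr) hl, Pi.single_eq_of_ne hl]
      simp
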